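/- Let $d\ge 0$, $m\ge 1$, let $\mathbb{T}^d=(\mathbb{R}/\mathbb{Z})^d$ with Haar probability measure $\mathfrak{m}$, and let $\mathscr{G}=\mathbb{T}^d\times C^0(\mathbb{T}^d,\mathrm{SL}_m(\mathbb{R}))$ be the topological group of quasiperiodic cocycles, with the product of the torus topology and the topology of uniform convergence, and with $(\alpha,A)\circ(\beta,B)=(\alpha+\beta,\,(A\circ\tau_\beta)B)$, $\tau_\beta(\theta)=\theta+\beta$. Let $\mathscr{G}$ act on $\mathbb{T}^d\times\mathbb{P}(\mathbb{R}^m)$ by $(\alpha,A)\cdot(\theta,\hat p)=(\theta+\alpha,A(\theta)\hat p)$. For a sequence $\omega=(\omega_n)$ in $\mathscr{G}$ let $\mathscr{A}^n(\omega)\in C^0(\mathbb{T}^d,\mathrm{SL}_m(\mathbb{R}))$ be the second component of $\omega_{n-1}\circ\cdots\circ\omega_1\circ\omega_0$. Norms are the Euclidean norm on $\mathbb{R}^m$ and the associated operator norm. Let $\nu$ be a compactly supported Borel probability measure on $\mathscr{G}$ that is ergodic, meaning that the map $f(\omega,\theta)=(\sigma\omega,\theta+\alpha_0)$, where $\omega_0=(\alpha_0,A_0)$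 and $\sigma$ is the shift, is ergodic on $(\mathscr{G}^{\mathbb{Z}}\times\mathbb{T}^d,\ \nu^{\mathbb{Z}}\times\mathfrak{m})$. Let $\mathrm{Prob}_\nu$ be the set of Borel probability measures $\eta$ on $\mathbb{T}^d\times\mathbb{P}(\mathbb{R}^m)$ with $\nu*\eta=\eta$, where $\nu*\eta$ is the image of $\nu\times\eta$ under $(g,x)\mapsto g\cdot x$, and for $\eta\in\mathrm{Prob}_\nu$ let $$\alpha_\nu(\eta)=\int_{\mathscr{G}}\int_{\mathbb{T}^d\times\mathbb{P}(\mathbb{R}^m)}\log\|A(\theta)p\|\,d\eta(\theta,\hat p)\,d\nu(\alpha,A),$$ where $p$ is a unit vector representing $\hat p$. Then for every $\eta\in\mathrm{Prob}_\nu$ the integrand is $\nu\times\eta$-integrable, the maximum $\beta(\nu)=\max\{\alpha_\nu(\eta):\eta\in\mathrm{Prob}_\nu\}$ exists, and the following hold. (1) $\displaystyle\lim_{n\to\infty}\frac1n\log\|\mathscr{A}^n(\omega)(\theta)\|=\beta(\nu)$ for $\nu^{\mathbb{N}}\times\mathfrak{m}$-a.e. $(\omega,\theta)$. In particular $L_1(\nu)=\beta(\nu)$,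 where the first Lyapunov exponent $L_1(\nu)$ is the limit of the integrals $\int\frac1n\log\|\mathscr{A}^n(\omega)(\theta)\|\,d(\nu^{\mathbb{Z}}\times\mathfrak{m})$; this limit exists, the integrands are integrable, and $\frac1n\log\|\mathscr{A}^n(\omega)(\theta)\|\to L_1(\nu)$ for $\nu^{\mathbb{Z}}\times\mathfrak{m}$-a.e. $(\omega,\theta)$. (2) For every $(\theta,v)\in\mathbb{T}^d\times\mathbb{R}^m$, for $\nu^{\mathbb{N}}$-a.e. $\omega$, $\displaystyle\limsup_{n\to\infty}\frac1n\log\|\mathscr{A}^n(\omega)(\theta)v\|\le\beta(\nu)$ (with $\log 0=-\infty$). (3) If $\alpha_\nu$ is constant on $\mathrm{Prob}_\nu$, then for every $\theta\in\mathbb{T}^d$ and $v\in\mathbb{R}^m\setminus\{0\}$, for $\nu^{\mathbb{N}}$-a.e. $\omega$, $\displaystyle\lim_{n\to\infty}\frac1n\log\|\mathscr{A}^n(\omega)(\theta)v\|=\beta(\nu)$. -/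

import Mathlib

open MeasureTheory Filter Topology
open scoped LinearAlgebra.Projectivization

noncomputable section

/-- A quasiperiodic cocycle `(α, A)`: a frequency `α ∈ 𝕋^d = (ℝ/ℤ)^d` together with a continuous map
`A : 𝕋^d → SL_m(ℝ)`. -/
def QPCocycle (d m : ℕ) : Type :=
  UnitAddTorus (Fin d) × C(UnitAddTorus (Fin d), Matrix.SpecialLinearGroup (Fin m) ℝ)

/-- The projective space `P(ℝ^m)`, on which `SL_m(ℝ)` acts by `A • [v] = [A v]`. -/
abbrev ProjSpace (m : ℕ) : Type := ℙ ℝ (Fin m → ℝ)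

/-- The quotient topology from `ℝ^m ∖ {0}`. -/
instance instTopologicalSpaceProjSpace (m : ℕ) : TopologicalSpace (ProjSpace m) :=
  inferInstanceAs (TopologicalSpace (Quotient (projectivizationSetoid ℝ (Fin m → ℝ))))

instance instMeasurableSpaceProjSpace (m : ℕ) : MeasurableSpace (ProjSpace m) := borel _

instance instBorelSpaceProjSpace (m : ℕ) : BorelSpace (ProjSpace m) := ⟨rfl⟩

/-- The product `𝕋^d × P(ℝ^m)`. -/
abbrev TorusProj (d m : ℕ) : Type := UnitAddTorus (Fin d) × ProjSpace m

/-- The Haar probability measure of the torus `𝕋^d = (ℝ/ℤ)^d`. -/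
def torusHaar (d : ℕ) : Measure (UnitAddTorus (Fin d)) :=
  Measure.pi fun _ : Fin d => (AddCircle.haarAddCircle : Measure UnitAddCircle)

namespace QPCocycle

variable {d m : ℕ}

/-- Product topology; the topology of `C(𝕋^d, SL_m(ℝ))` is that of uniform convergence. -/
instance : TopologicalSpace (QPCocycle d m) :=
  inferInstanceAs (TopologicalSpace
    (UnitAddTorus (Fin d) × C(UnitAddTorus (Fin d), Matrix.SpecialLinearGroup (Fin m) ℝ)))

instance : MeasurableSpace (QPCocycle d m) := borel _

instance : BorelSpace (QPCocycle d m) := ⟨rfl⟩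

/-- The frequency `α` of `(α, A)`. -/
def freq (g : QPCocycle d m) : UnitAddTorus (Fin d) := g.1

/-- The matrix valued function `A` of `(α, A)`. -/
def mat (g : QPCocycle d m) :
    C(UnitAddTorus (Fin d), Matrix.SpecialLinearGroup (Fin m) ℝ) := g.2

/-- The torus translation `θ ↦ θ + β`. -/
def translation (β : UnitAddTorus (Fin d)) :
    C(UnitAddTorus (Fin d), UnitAddTorus (Fin d)) := ⟨fun θ => θ + β, by fun_prop⟩

/-- `(α, A) ∘ (β, B) = (α + β, (A ∘ τ_β) B)`. -/
instance : Mul (QPCocycle d m) :=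
  ⟨fun g h => (g.freq + h.freq, g.mat.comp (translation h.freq) * h.mat)⟩

instance : One (QPCocycle d m) := ⟨((0 : UnitAddTorus (Fin d)), 1)⟩

/-- `(α, A)⁻¹ = (-α, (A ∘ τ_{-α})⁻¹)`. -/
instance : Inv (QPCocycle d m) :=
  ⟨fun g => (-g.freq, (g.mat.comp (translation (-g.freq)))⁻¹)⟩

@[simp] lemma freq_mul (g h : QPCocycle d m) : (g * h).freq = g.freq + h.freq := rfl

@[simp] lemma freq_one : (1 : QPCocycle d m).freq = 0 := rfl

@[simp] lemma freq_inv (g : QPCocycle d m) : g⁻¹.freq = -g.freq := rfl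

@[simp] lemma mat_mul (g h : QPCocycle d m) (θ : UnitAddTorus (Fin d)) :
    (g * h).mat θ = g.mat (θ + h.freq) * h.mat θ := rfl

@[simp] lemma mat_one (θ : UnitAddTorus (Fin d)) : (1 : QPCocycle d m).mat θ = 1 := rfl

@[simp] lemma mat_inv (g : QPCocycle d m) (θ : UnitAddTorus (Fin d)) :
    g⁻¹.mat θ = (g.mat (θ + -g.freq))⁻¹ := rfl

lemma ext_iff' {g h : QPCocycle d m} :
    g = h ↔ g.freq = h.freq ∧ ∀ θ, g.mat θ = h.mat θ :=
  ⟨by rintro rfl; simp, fun H => Prod.ext H.1 (ContinuousMap.ext H.2)⟩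

instance : Group (QPCocycle d m) where
  mul_assoc a b c := by
    rw [ext_iff']; exact ⟨by simp [add_assoc], fun θ => by
      simp [mul_assoc, add_assoc, add_comm c.freq b.freq]⟩
  one_mul a := by rw [ext_iff']; simp
  mul_one a := by rw [ext_iff']; simp
  inv_mul_cancel a := by rw [ext_iff']; simp

/-- The action `(α, A) · (θ, p) = (θ + α, A(θ) p)` on `𝕋^d × P(ℝ^m)`. -/
instance : MulAction (QPCocycle d m) (TorusProj d m) where
  smul g x := (x.1 + g.freq, g.mat x.1 • x.2)
  one_smul x := by
    change (x.1 + (1 : QPCocycle d m).freq, (1 : QPCocycle d m).mat x.1 • x.2) = x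
    simp
  mul_smul g h x := by
    change (x.1 + (g * h).freq, (g * h).mat x.1 • x.2)
      = (x.1 + h.freq + g.freq, g.mat (x.1 + h.freq) • (h.mat x.1 • x.2))
    simp [mul_smul, add_assoc, add_comm h.freq g.freq]

lemma smul_def (g : QPCocycle d m) (x : TorusProj d m) :
    g • x = (x.1 + g.freq, g.mat x.1 • x.2) := rfl

/-- The operator of `A(θ)` on `ℝ^m` with the Euclidean norm. -/
def op (g : QPCocycle d m) (θ : UnitAddTorus (Fin d)) :
    EuclideanSpace ℝ (Fin m) →L[ℝ] EuclideanSpace ℝ (Fin m) :=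
  Matrix.toEuclideanCLM (𝕜 := ℝ) (g.mat θ : Matrix (Fin m) (Fin m) ℝ)

/-- `Π_n = ω_{n-1} ∘ ⋯ ∘ ω_1 ∘ ω_0`. -/
def iter (ω : ℕ → QPCocycle d m) : ℕ → QPCocycle d m
  | 0 => 1
  | n + 1 => ω n * iter ω n

/-- The iterate `𝒜^n(ω)(θ)` as an operator on Euclidean `ℝ^m`. -/
def iterOp (ω : ℕ → QPCocycle d m) (n : ℕ) (θ : UnitAddTorus (Fin d)) :
    EuclideanSpace ℝ (Fin m) →L[ℝ] EuclideanSpace ℝ (Fin m) :=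
  (iter ω n).op θ

/-- The mixed base dynamics `f(ω, θ) = (σ ω, θ + 𝔞(ω_0))` on two-sided sequences. -/
def baseMap (z : (ℤ → QPCocycle d m) × UnitAddTorus (Fin d)) :
    (ℤ → QPCocycle d m) × UnitAddTorus (Fin d) :=
  (fun n => z.1 (n + 1), z.2 + (z.1 0).freq)

/-- `ν^ℤ × m`, with `m` the Haar probability measure of the torus. -/
def twoSidedMeasure (ν : Measure (QPCocycle d m)) :
    Measure ((ℤ → QPCocycle d m) × UnitAddTorus (Fin d)) :=
  (Measure.infinitePi fun _ : ℤ => ν).prod (torusHaar d)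

/-- `ν` is ergodic when the mixed base dynamics is ergodic for `ν^ℤ × m`. -/
def IsErgodic (ν : Measure (QPCocycle d m)) : Prop :=
  Ergodic (baseMap (d := d) (m := m)) (twoSidedMeasure ν)

/-- `(1/n) log ‖𝒜^n(ω)(θ)‖` for a two-sided sequence `ω`. -/
def logAverage (n : ℕ) (z : (ℤ → QPCocycle d m) × UnitAddTorus (Fin d)) : ℝ :=
  (1 / (n : ℝ)) * Real.log ‖iterOp (fun k : ℕ => z.1 (k : ℤ)) n z.2‖

/-- The first Lyapunov exponent `L_1(ν) = lim ∫ (1/n) log ‖𝒜^n‖ d(ν^ℤ × m)`. -/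
def lyapunovExponent (ν : Measure (QPCocycle d m)) : ℝ :=
  limUnder atTop fun n : ℕ => ∫ z, logAverage n z ∂(twoSidedMeasure ν)

/-- The convolution `ν ∗ η (E) = ∫∫ 1_E(g · x) dν(g) dη(x)`. -/
def conv (ν : Measure (QPCocycle d m)) (η : Measure (TorusProj d m)) :
    Measure (TorusProj d m) :=
  (ν.prod η).map fun z => z.1 • z.2

/-- The `ν`-stationary probability measures on `𝕋^d × P(ℝ^m)`. -/
def stationaryMeasures (ν : Measure (QPCocycle d m)) : Set (Measure (TorusProj d m)) :=
  {η | IsProbabilityMeasure η ∧ conv ν η = η}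

/-- `Ψ_g(θ, p) = log ‖A(θ) p‖` with `p` a unit vector representing the projective point. -/
def psi (g : QPCocycle d m) (x : TorusProj d m) : ℝ :=
  Real.log ‖g.op x.1 ((‖WithLp.toLp 2 x.2.rep‖)⁻¹ • WithLp.toLp 2 x.2.rep)‖

/-- `α_ν(η) = ∫∫ Ψ_g(θ, p) dη(θ, p) dν(g)`. -/
def alpha (ν : Measure (QPCocycle d m)) (η : Measure (TorusProj d m)) : ℝ :=
  ∫ g, ∫ x, psi g x ∂η ∂ν

/-- `β(ν)`, the largest value of `α_ν` on stationary measures. -/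
def beta (ν : Measure (QPCocycle d m)) : ℝ :=
  sSup (alpha ν '' stationaryMeasures ν)

end QPCocycle

end

/-! The argument is of Furstenberg–Kifer type. Along the random walk on `𝕋^d × P(ℝ^m)`, `log ‖𝒜^n
v‖` is, up to the constant `log ‖v‖`, the sum of `psi` over the projective orbit
(`log_norm_iterOp`). Compact support lets `psi` be replaced by a bounded `F` with continuous mean `φ
x = ∫ F g x dν`, and by Fubini `α_ν(η) = ∫ φ dη`.

Upper bound. Centred increments have uncorrelated terms, so their sums are `o(n)` almost surely
(`ae_tendsto_orbitSum_div`). Hence, along the orbit of any fixed point, sums of `F` may be replaced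
by sums of `φ`, and these by sums of any Cesàro mean of `φ` under the transition operator. Weak
limits of Cesàro means are stationary, so the supremum of a suitable Cesàro mean is as close as
desired to the maximum `β(ν)` (`exists_isGreatest_integral`). This bounds the growth of every
vector, hence of the operator norm through a basis.

Lower bound. Let `η` attain the maximum. The skew product preserves `ν^ℕ × η`, the upper averages of
`F` are at most `β(ν)`, and the mean of `F` is exactly `β(ν)`. The maximal ergodic inequality then
leaves no room for smaller lower averages (`ae_tendsto_birkhoffAverage_of_max`), so no ergodicity of
the skew product is needed. Some direction over almost every `(ω, θ)` therefore grows at rate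
`β(ν)`; "almost every" refers to Haar measure because ergodicity of `ν` forces the torus marginal of
`η` to be Haar (`eq_torusHaar`, by Fourier coefficients). This gives (1), and dominated convergence
gives the statement on means.

For (3), if `α_ν` is constant, then the maximum for `-φ` is `-β(ν)`, and the upper bound applied to
`-F` is the missing lower bound. -/

section RandomWalk

/-! ### Random orbits and a law of large numbers for centred increments. -/

variable {G X : Type*}

/-- Prepend a term to a sequence. -/
def consSeq (g : G) (ω : ℕ → G) : ℕ → G
  | 0 => g
  | n + 1 => ω n

@[simp] lemma consSeq_zero (g : G) (ω : ℕ → G) : consSeq g ω 0 = g := rfl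

@[simp] lemma consSeq_succ (g : G) (ω : ℕ → G) (n : ℕ) : consSeq g ω (n + 1) = ω n := rfl

lemma measurable_consSeq [MeasurableSpace G] :
    Measurable fun p : G × (ℕ → G) => consSeq p.1 p.2 := by
  refine measurable_pi_lambda _ fun n => ?_
  cases n with
  | zero => exact measurable_fst
  | succ n => exact (measurable_pi_apply n).comp measurable_snd

/-- This is what allows conditioning on the first step of the walk. It suffices to compare the
measures of cylinders. -/
lemma measurePreserving_consSeq [MeasurableSpace G] (ν : Measure G) [IsProbabilityMeasure ν] :
    MeasurePreserving (fun p : G × (ℕ → G) => consSeq p.1 p.2)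
      (ν.prod (Measure.infinitePi fun _ : ℕ => ν)) (Measure.infinitePi fun _ : ℕ => ν) := by
  refine ⟨measurable_consSeq, Measure.eq_infinitePi _ fun s t ht => ?_⟩
  classical
  -- Enlarging the index set to an initial segment makes the coordinate `0` split off from the
  -- shifted ones.
  obtain ⟨N, hN⟩ : ∃ N, s ⊆ Finset.range (N + 1) :=
    ⟨s.sup id, fun i hi => Finset.mem_range_succ_iff.2 (Finset.le_sup (f := id) hi)⟩
  set t' : ℕ → Set G := fun i => if i ∈ s then t i else Set.univ with ht'
  have hmt' : ∀ i, MeasurableSet (t' i) := fun i => by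
    simp only [ht']; split_ifs; exacts [ht i, MeasurableSet.univ]
  have hset : (s : Set ℕ).pi t = ((Finset.range (N + 1) : Finset ℕ) : Set ℕ).pi t' := by
    ext ω
    simp only [Set.mem_pi, Finset.mem_coe, ht']
    refine ⟨fun h i _ => ?_, fun h i hi => ?_⟩
    · split_ifs with hi
      exacts [h i hi, Set.mem_univ _]
    · simpa [hi] using h i (hN hi)
  have hprod : ∏ i ∈ s, ν (t i) = ∏ i ∈ Finset.range (N + 1), ν (t' i) := by
    rw [← Finset.prod_subset hN fun i _ hi => by simp [ht', hi]]
    exact Finset.prod_congr rfl fun i hi => by simp [ht', hi]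
  have hpre : (fun p : G × (ℕ → G) => consSeq p.1 p.2) ⁻¹'
      ((Finset.range (N + 1) : Finset ℕ) : Set ℕ).pi t' =
      t' 0 ×ˢ ((Finset.range N : Finset ℕ) : Set ℕ).pi fun i => t' (i + 1) := by
    ext p
    simp only [Set.mem_preimage, Set.mem_pi, Finset.mem_coe, Finset.mem_range, Set.mem_prod]
    refine ⟨fun h => ⟨h 0 (by omega), fun i hi => h (i + 1) (by omega)⟩, fun h i hi => ?_⟩
    cases i with
    | zero => exact h.1
    | succ i => exact h.2 i (by omega)
  rw [hset, hprod, Measure.map_apply measurable_consSeq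
    (MeasurableSet.pi (Finset.countable_toSet _) fun i _ => hmt' i), hpre, Measure.prod_prod,
    Measure.infinitePi_pi _ fun i _ => hmt' (i + 1), Finset.prod_range_succ', mul_comm]

variable [SMul G X]

/-- The random orbit `x_0 = x`, `x_{n+1} = ω_n • x_n`. -/
def randomOrbit (ω : ℕ → G) (x : X) : ℕ → X
  | 0 => x
  | n + 1 => ω n • randomOrbit ω x n

@[simp] lemma randomOrbit_zero (ω : ℕ → G) (x : X) : randomOrbit ω x 0 = x := rfl

lemma randomOrbit_succ (ω : ℕ → G) (x : X) (n : ℕ) :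
    randomOrbit ω x (n + 1) = ω n • randomOrbit ω x n := rfl

/-- Splitting at the first step instead of the last turns the tail into an orbit of the same kind
from a new starting point, which drives the inductions below. -/
lemma randomOrbit_succ' (ω : ℕ → G) (x : X) (n : ℕ) :
    randomOrbit ω x (n + 1) = randomOrbit (fun k => ω (k + 1)) (ω 0 • x) n := by
  induction n with
  | zero => rfl
  | succ n ih => rw [randomOrbit_succ, ih]; rfl

/-- The sum of `F` along a random orbit. -/
def orbitSum (F : G → X → ℝ) (n : ℕ) (ω : ℕ → G) (x : X) : ℝ :=
  ∑ j ∈ Finset.range n, F (ω j) (randomOrbit ω x j)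

lemma orbitSum_succ (F : G → X → ℝ) (n : ℕ) (ω : ℕ → G) (x : X) :
    orbitSum F (n + 1) ω x = orbitSum F n ω x + F (ω n) (randomOrbit ω x n) :=
  Finset.sum_range_succ _ _

lemma orbitSum_succ' (F : G → X → ℝ) (n : ℕ) (ω : ℕ → G) (x : X) :
    orbitSum F (n + 1) ω x = F (ω 0) x + orbitSum F n (fun k => ω (k + 1)) (ω 0 • x) := by
  rw [orbitSum, Finset.sum_range_succ', add_comm]
  simp [orbitSum, randomOrbit_succ']

lemma orbitSum_consSeq (F : G → X → ℝ) (n : ℕ) (g : G) (ω : ℕ → G) (x : X) :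
    orbitSum F (n + 1) (consSeq g ω) x = F g x + orbitSum F n ω (g • x) :=
  orbitSum_succ' F n _ x

lemma orbitSum_sub (F H : G → X → ℝ) (n : ℕ) (ω : ℕ → G) (x : X) :
    orbitSum (fun g y => F g y - H g y) n ω x = orbitSum F n ω x - orbitSum H n ω x :=
  Finset.sum_sub_distrib ..

lemma abs_orbitSum_le {F : G → X → ℝ} {C : ℝ} (hC : ∀ g x, |F g x| ≤ C) (n : ℕ) (ω : ℕ → G)
    (x : X) : |orbitSum F n ω x| ≤ n * C := by
  refine (Finset.abs_sum_le_sum_abs _ _).trans ((Finset.sum_le_sum fun j _ => hC _ _).trans ?_)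
  simp

variable [MeasurableSpace G] [MeasurableSpace X] [MeasurableSMul₂ G X]

lemma measurable_randomOrbit (n : ℕ) :
    Measurable fun p : (ℕ → G) × X => randomOrbit p.1 p.2 n := by
  induction n with
  | zero => exact measurable_snd
  | succ n ih => exact ((measurable_pi_apply n).comp measurable_fst).smul ih

lemma measurable_orbitSum {F : G → X → ℝ} (hF : Measurable (Function.uncurry F)) (n : ℕ) :
    Measurable fun p : (ℕ → G) × X => orbitSum F n p.1 p.2 :=
  Finset.measurable_sum _ fun j _ => hF.comp
    (((measurable_pi_apply j).comp measurable_fst).prodMk (measurable_randomOrbit j))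

lemma measurable_orbitSum_left {F : G → X → ℝ} (hF : Measurable (Function.uncurry F)) (n : ℕ)
    (x : X) : Measurable fun ω => orbitSum F n ω x :=
  (measurable_orbitSum hF n).comp measurable_prodMk_right

variable (ν : Measure G) [IsProbabilityMeasure ν]

local notation "ℙν" => Measure.infinitePi fun _ : ℕ => ν

lemma integral_infinitePi_consSeq {f : (ℕ → G) → ℝ} (hf : Measurable f) {C : ℝ}
    (hC : ∀ ω, |f ω| ≤ C) :
    ∫ ω, f ω ∂ℙν = ∫ g, ∫ ω, f (consSeq g ω) ∂ℙν ∂ν := by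
  rw [← (measurePreserving_consSeq ν).map_eq, integral_map measurable_consSeq.aemeasurable
    hf.aestronglyMeasurable, (measurePreserving_consSeq ν).map_eq]
  exact integral_prod (fun p : G × (ℕ → G) => f (consSeq p.1 p.2))
    (Integrable.of_bound (hf.comp measurable_consSeq).aestronglyMeasurable C
      (ae_of_all _ fun p => hC _))

variable {ν} in
lemma integrable_orbitSum {F : G → X → ℝ} (hF : Measurable (Function.uncurry F)) {C : ℝ}
    (hC : ∀ g x, |F g x| ≤ C) (n : ℕ) (x : X) :
    Integrable (fun ω => orbitSum F n ω x) ℙν :=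
  Integrable.of_bound (measurable_orbitSum_left hF n x).aestronglyMeasurable
    (n * C) (ae_of_all _ fun ω => abs_orbitSum_le hC n ω x)

lemma integral_orbitSum_eq_zero {F : G → X → ℝ} (hF : Measurable (Function.uncurry F)) {C : ℝ}
    (hC : ∀ g x, |F g x| ≤ C) (h0 : ∀ x, ∫ g, F g x ∂ν = 0) (n : ℕ) (x : X) :
    ∫ ω, orbitSum F n ω x ∂ℙν = 0 := by
  induction n generalizing x with
  | zero => simp [orbitSum]
  | succ n ih =>
    rw [integral_infinitePi_consSeq ν (measurable_orbitSum_left hF _ x)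
      fun ω => abs_orbitSum_le hC _ ω x]
    simp only [orbitSum_consSeq]
    have : ∀ g, ∫ ω, (F g x + orbitSum F n ω (g • x)) ∂ℙν = F g x := fun g => by
      rw [integral_add (integrable_const _) (integrable_orbitSum hF hC n _), ih]; simp
    simp [this, h0]

/-- The increments are uncorrelated: once the first step is fixed, the remaining sum has mean zero
from whatever point it starts, so the cross term vanishes and each step adds at most `C ^ 2`. -/
lemma integral_orbitSum_sq_le {F : G → X → ℝ} (hF : Measurable (Function.uncurry F)) {C : ℝ}
    (hC : ∀ g x, |F g x| ≤ C) (h0 : ∀ x, ∫ g, F g x ∂ν = 0) (n : ℕ) (x : X) :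
    ∫ ω, orbitSum F n ω x ^ 2 ∂ℙν ≤ n * C ^ 2 := by
  have hsq : ∀ (n : ℕ) x, Integrable (fun ω => orbitSum F n ω x ^ 2) ℙν := fun n x =>
    Integrable.of_bound
      ((measurable_orbitSum_left hF n x).pow_const 2).aestronglyMeasurable
      ((n * C) ^ 2) (ae_of_all _ fun ω => by
        rw [Real.norm_eq_abs, abs_pow]
        exact pow_le_pow_left₀ (abs_nonneg _) (abs_orbitSum_le hC n ω x) 2)
  induction n generalizing x with
  | zero => simp [orbitSum]
  | succ n ih =>
    rw [integral_infinitePi_consSeq ν (C := (((n + 1 : ℕ) : ℝ) * C) ^ 2)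
      ((measurable_orbitSum_left hF (n + 1) x).pow_const 2)
      fun ω => by
        rw [abs_pow]
        exact pow_le_pow_left₀ (abs_nonneg _) (abs_orbitSum_le hC _ ω x) 2]
    simp only [orbitSum_consSeq]
    have key : ∀ g, ∫ ω, (F g x + orbitSum F n ω (g • x)) ^ 2 ∂ℙν ≤ (n + 1 : ℕ) * C ^ 2 := by
      intro g
      have e : ∀ ω, (F g x + orbitSum F n ω (g • x)) ^ 2 =
          F g x ^ 2 + 2 * F g x * orbitSum F n ω (g • x) + orbitSum F n ω (g • x) ^ 2 :=
        fun ω => by ring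
      simp_rw [e]
      have i1 := (integrable_orbitSum (ν := ν) hF hC n (g • x)).const_mul (2 * F g x)
      have i2 : Integrable (fun ω => F g x ^ 2 + 2 * F g x * orbitSum F n ω (g • x)) ℙν :=
        (integrable_const _).add i1
      rw [integral_add i2 (hsq n _),
        integral_add (integrable_const _) i1, integral_const_mul,
        integral_orbitSum_eq_zero ν hF hC h0]
      have h1 : F g x ^ 2 ≤ C ^ 2 := by
        rw [← sq_abs]; exact pow_le_pow_left₀ (abs_nonneg _) (hC g x) 2
      have h2 := ih (g • x)
      push_cast
      simp only [integral_const, probReal_univ, smul_eq_mul]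
      linarith
    -- A non-integrable function has Bochner integral `0`, so integrability in `g` need not be
    -- proved.
    by_cases hi : Integrable (fun g => ∫ ω, (F g x + orbitSum F n ω (g • x)) ^ 2 ∂ℙν) ν
    · refine (integral_mono hi (integrable_const _) key).trans ?_
      simp
    · rw [integral_undef hi]; positivity

/-- A sequence with bounded increments and second moments of linear growth is almost surely `o(n)`. -/
lemma ae_tendsto_div_of_integral_sq_le {Ω : Type*} [MeasurableSpace Ω] {μ : Measure Ω}
    {S : ℕ → Ω → ℝ} {C D : ℝ} (hS : ∀ n, Measurable (S n)) (hi : ∀ n, Integrable (fun ω => S n ω ^ 2) μ)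
    (hinc : ∀ n ω, |S (n + 1) ω - S n ω| ≤ C) (hD : ∀ n : ℕ, ∫ ω, S n ω ^ 2 ∂μ ≤ n * D) :
    ∀ᵐ ω ∂μ, Tendsto (fun n : ℕ => S n ω / n) atTop (𝓝 0) := by
  -- Along the squares the second moments of `S (k ^ 2) / k ^ 2` are at most `D / k ^ 2`, which is
  -- summable, so almost surely these squares form a convergent series.
  have hsub : ∀ᵐ ω ∂μ, Tendsto (fun k : ℕ => S (k ^ 2) ω / (k ^ 2 : ℕ)) atTop (𝓝 0) := by
    have hsum : ∑' k : ℕ, ∫⁻ ω, ENNReal.ofReal ((S (k ^ 2) ω / (k ^ 2 : ℕ)) ^ 2) ∂μ ≠ ⊤ := by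
      have hle : ∀ k : ℕ, ∫⁻ ω, ENNReal.ofReal ((S (k ^ 2) ω / (k ^ 2 : ℕ)) ^ 2) ∂μ ≤
          ENNReal.ofReal (D * (1 / (k : ℝ) ^ 2)) := by
        intro k
        rw [← ofReal_integral_eq_lintegral_ofReal]
        · refine ENNReal.ofReal_le_ofReal ?_
          simp_rw [div_pow, integral_div]
          rcases Nat.eq_zero_or_pos k with rfl | hk
          · simp
          have hk' : (0 : ℝ) < k := by exact_mod_cast hk
          rw [div_le_iff₀ (by positivity)]
          refine (hD _).trans (le_of_eq ?_)
          push_cast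
          field_simp
        · simp_rw [div_pow]
          exact (hi _).div_const _
        · exact ae_of_all _ fun ω => sq_nonneg _
      refine ne_top_of_le_ne_top ?_ (ENNReal.tsum_le_tsum hle)
      exact (((Real.summable_one_div_nat_pow (p := 2)).2 one_lt_two).mul_left D).tsum_ofReal_ne_top
    rw [← lintegral_tsum fun k => by
      exact (((hS _).div_const _).pow_const 2).ennreal_ofReal.aemeasurable] at hsum
    have hae := ae_lt_top (Measurable.tsum fun k =>
      (((hS (k ^ 2)).div_const ((k ^ 2 : ℕ) : ℝ)).pow_const 2).ennreal_ofReal) hsum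
    filter_upwards [hae] with ω hω
    have h1 := ENNReal.tendsto_atTop_zero_of_tsum_ne_top hω.ne
    have h2 := (ENNReal.tendsto_toReal ENNReal.zero_ne_top).comp h1
    have h3 : Tendsto (fun k : ℕ => (S (k ^ 2) ω / (k ^ 2 : ℕ)) ^ 2) atTop (𝓝 0) := by
      refine h2.congr fun k => ?_
      simp only [Function.comp]
      rw [ENNReal.toReal_ofReal (sq_nonneg _)]
    have h4 := h3.sqrt
    simp only [Real.sqrt_sq_eq_abs, Real.sqrt_zero] at h4
    exact (tendsto_zero_iff_abs_tendsto_zero _).2 h4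
  filter_upwards [hsub] with ω hω
  -- Bounded increments control `S` between consecutive squares, where at most `2 * √n` steps are
  -- taken.
  have hgap : ∀ n j : ℕ, |S (n + j) ω - S n ω| ≤ j * C := by
    intro n j
    induction j with
    | zero => simp
    | succ j ih =>
      have := hinc (n + j) ω
      calc |S (n + (j + 1)) ω - S n ω|
          = |(S (n + j + 1) ω - S (n + j) ω) + (S (n + j) ω - S n ω)| := by
            congr 1; rw [← add_assoc]; ring
        _ ≤ C + j * C := (abs_add_le _ _).trans (add_le_add this ih)
        _ = ((j + 1 : ℕ) : ℝ) * C := by push_cast; ring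
  have hC0 : 0 ≤ C := (abs_nonneg _).trans (hinc 0 ω)
  have hsqrt : Tendsto Nat.sqrt atTop atTop :=
    tendsto_atTop_atTop.2 fun b => ⟨b * b, fun a ha => Nat.le_sqrt.2 ha⟩
  have hbound : Tendsto (fun n : ℕ => |S (n.sqrt ^ 2) ω / (n.sqrt ^ 2 : ℕ)| + 2 * C / (n.sqrt : ℕ))
      atTop (𝓝 0) := by
    have h1 := (hω.comp hsqrt).abs
    have h2 := ((tendsto_natCast_atTop_atTop (R := ℝ)).comp hsqrt).const_div_atTop (2 * C)
    simpa using h1.add h2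
  refine squeeze_zero_norm' ?_ hbound
  filter_upwards [eventually_ge_atTop 1] with n hn
  have hk : 0 < n.sqrt := Nat.sqrt_pos.2 hn
  have hk' : (0 : ℝ) < n.sqrt := by exact_mod_cast hk
  have hle : n.sqrt ^ 2 ≤ n := Nat.sqrt_le' n
  have hn' : (0 : ℝ) < n := by exact_mod_cast hn
  obtain ⟨j, hj⟩ := Nat.exists_eq_add_of_le hle
  have hj2 : j ≤ 2 * n.sqrt := by
    have := Nat.sqrt_le_add n
    nlinarith
  have hj2' : (j : ℝ) ≤ 2 * n.sqrt := by exact_mod_cast hj2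
  have hle' : ((n.sqrt : ℝ)) ^ 2 ≤ n := by exact_mod_cast hle
  have h1 : |S n ω| ≤ |S (n.sqrt ^ 2) ω| + 2 * n.sqrt * C := by
    have h := hgap (n.sqrt ^ 2) j
    rw [← hj] at h
    have h' := abs_sub_abs_le_abs_sub (S n ω) (S (n.sqrt ^ 2) ω)
    nlinarith
  rw [Real.norm_eq_abs, abs_div, abs_div, Nat.abs_cast, Nat.abs_cast]
  calc |S n ω| / n ≤ |S (n.sqrt ^ 2) ω| / n + 2 * n.sqrt * C / n := by
        rw [← add_div]; gcongr
    _ ≤ |S (n.sqrt ^ 2) ω| / (n.sqrt ^ 2 : ℕ) + 2 * n.sqrt * C / (n.sqrt : ℝ) ^ 2 := by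
        gcongr
    _ = _ := by
        congr 1; field_simp

/-- Strong law of large numbers for the increments of a function along a random orbit. -/
lemma ae_tendsto_orbitSum_div {F : G → X → ℝ} (hF : Measurable (Function.uncurry F)) {C : ℝ}
    (hC : ∀ g x, |F g x| ≤ C) (h0 : ∀ x, ∫ g, F g x ∂ν = 0) (x : X) :
    ∀ᵐ ω ∂ℙν, Tendsto (fun n : ℕ => orbitSum F n ω x / n) atTop (𝓝 0) := by
  refine ae_tendsto_div_of_integral_sq_le (C := C) (D := C ^ 2)
    (fun n => measurable_orbitSum_left hF n x) (fun n => ?_)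
    (fun n ω => ?_) (fun n => integral_orbitSum_sq_le ν hF hC h0 n x)
  · refine Integrable.of_bound
      ((measurable_orbitSum_left hF n x).pow_const 2).aestronglyMeasurable
      ((n * C) ^ 2) (ae_of_all _ fun ω => ?_)
    rw [Real.norm_eq_abs, abs_pow]
    exact pow_le_pow_left₀ (abs_nonneg _) (abs_orbitSum_le hC n ω x) 2
  · rw [orbitSum_succ, add_sub_cancel_left]
    exact hC _ _

end RandomWalk

/-! ### Maximal ergodic inequality and a pointwise ergodic theorem. -/

section PointwiseErgodic

/-- Convergence of `max (u n) c` to `c` encodes `limsup u ≤ c` without boundedness conditions on a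
real `limsup`, and it suits dominated convergence and measurability of the convergence set. -/
lemma tendsto_max_iff_forall_gt {u : ℕ → ℝ} {c : ℝ} :
    Tendsto (fun n => max (u n) c) atTop (𝓝 c) ↔ ∀ b > c, ∀ᶠ n in atTop, u n < b := by
  refine ⟨fun h b hb => ?_, fun h => ?_⟩
  · filter_upwards [h.eventually_lt_const hb] with n hn using (le_max_left _ _).trans_lt hn
  · refine tendsto_order.2 ⟨fun a ha => Eventually.of_forall fun n => ha.trans_le (le_max_right _ _),
      fun b hb => ?_⟩
    filter_upwards [h b hb] with n hn using max_lt hn hb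

variable {Ω : Type*} {T : Ω → Ω}

lemma abs_birkhoffSum_le {f : Ω → ℝ} {C : ℝ} (hC : ∀ z, |f z| ≤ C) (n : ℕ) (z : Ω) :
    |birkhoffSum T f n z| ≤ n * C := by
  refine (Finset.abs_sum_le_sum_abs _ _).trans ((Finset.sum_le_sum fun j _ => hC _).trans ?_)
  simp

/-- The running maximum of the Birkhoff sums of orders `0, …, n`. -/
def birkhoffMax (T : Ω → Ω) (f : Ω → ℝ) : ℕ → Ω → ℝ
  | 0 => fun _ => 0
  | n + 1 => fun z => max (birkhoffMax T f n z) (birkhoffSum T f (n + 1) z)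

lemma birkhoffMax_nonneg (f : Ω → ℝ) (n : ℕ) (z : Ω) : 0 ≤ birkhoffMax T f n z := by
  induction n with
  | zero => exact le_rfl
  | succ n ih => exact ih.trans (le_max_left _ _)

lemma birkhoffSum_le_birkhoffMax (f : Ω → ℝ) {k n : ℕ} (h : k ≤ n) (z : Ω) :
    birkhoffSum T f k z ≤ birkhoffMax T f n z := by
  induction n with
  | zero => simp [Nat.le_zero.1 h, birkhoffMax]
  | succ n ih =>
    rcases Nat.le_or_eq_of_le_succ h with h | rfl
    · exact (ih h).trans (le_max_left _ _)
    · exact le_max_right _ _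

/-- Garsia's inequality: a positive maximum is attained at some order `k + 1`, and the sum of that
order is `f z` plus a sum of order `k` at `T z`. -/
lemma birkhoffMax_le_of_pos (f : Ω → ℝ) (n : ℕ) (z : Ω) (h : 0 < birkhoffMax T f n z) :
    birkhoffMax T f n z ≤ f z + birkhoffMax T f n (T z) := by
  have key : ∀ k ≤ n, 0 < birkhoffMax T f k z →
      birkhoffMax T f k z ≤ f z + birkhoffMax T f n (T z) := by
    intro k
    induction k with
    | zero => intro _ h; exact absurd h (lt_irrefl _)
    | succ k ih =>
      intro hk hpos
      have hS : birkhoffSum T f (k + 1) z ≤ f z + birkhoffMax T f n (T z) := by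
        rw [birkhoffSum_succ']
        gcongr
        exact birkhoffSum_le_birkhoffMax f (by omega) _
      rcases lt_or_ge 0 (birkhoffMax T f k z) with h0 | h0
      · exact max_le (ih (by omega) h0) hS
      · rcases lt_max_iff.1 hpos with h1 | h1
        · exact absurd h1 h0.not_gt
        · exact max_le (h0.trans (h1.le.trans hS)) hS
  exact key n le_rfl h

lemma abs_birkhoffMax_le {f : Ω → ℝ} {C : ℝ} (hC : ∀ z, |f z| ≤ C) (n : ℕ) (z : Ω) :
    |birkhoffMax T f n z| ≤ n * C := by
  have hC0 : 0 ≤ C := (abs_nonneg _).trans (hC z)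
  rw [abs_of_nonneg (birkhoffMax_nonneg f n z)]
  induction n with
  | zero => simp [birkhoffMax]
  | succ n ih =>
    refine max_le (ih.trans ?_) ((le_abs_self _).trans (abs_birkhoffSum_le hC _ z))
    gcongr; simp

variable [MeasurableSpace Ω] {μ : Measure Ω}

lemma measurable_birkhoffSum (hT : Measurable T) {f : Ω → ℝ} (hf : Measurable f) (n : ℕ) :
    Measurable (birkhoffSum T f n) :=
  Finset.measurable_sum _ fun j _ => hf.comp (hT.iterate j)

lemma measurable_birkhoffMax (hT : Measurable T) {f : Ω → ℝ} (hf : Measurable f) (n : ℕ) :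
    Measurable (birkhoffMax T f n) := by
  induction n with
  | zero => exact measurable_const
  | succ n ih => exact ih.max (measurable_birkhoffSum hT hf _)

/-- The maximal ergodic inequality. -/
lemma setIntegral_birkhoffSum_pos_nonneg [IsFiniteMeasure μ] (hT : MeasurePreserving T μ μ)
    {f : Ω → ℝ} (hf : Measurable f) {C : ℝ} (hC : ∀ z, |f z| ≤ C) :
    0 ≤ ∫ z in {z | ∃ n, 0 < birkhoffSum T f n z}, f z ∂μ := by
  have hfi : Integrable f μ := Integrable.of_bound hf.aestronglyMeasurable C (ae_of_all _ hC)
  have hmeas : ∀ n, MeasurableSet {z | 0 < birkhoffMax T f n z} := fun n =>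
    measurableSet_lt measurable_const (measurable_birkhoffMax hT.measurable hf n)
  have hset : {z | ∃ n, 0 < birkhoffSum T f n z} = ⋃ n, {z | 0 < birkhoffMax T f n z} := by
    ext z
    simp only [Set.mem_ofPred_eq, Set.mem_iUnion]
    refine ⟨fun ⟨n, hn⟩ => ⟨n, hn.trans_le (birkhoffSum_le_birkhoffMax f le_rfl z)⟩, fun ⟨n, hn⟩ => ?_⟩
    induction n with
    | zero => exact absurd hn (lt_irrefl _)
    | succ n ih =>
      rcases lt_max_iff.1 hn with h | h
      exacts [ih h, ⟨_, h⟩]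
  have hmono : Monotone fun n => {z | 0 < birkhoffMax T f n z} :=
    monotone_nat_of_le_succ fun n z (hz : 0 < birkhoffMax T f n z) =>
      show 0 < birkhoffMax T f (n + 1) z from lt_of_lt_of_le hz (le_max_left _ _)
  rw [hset]
  refine ge_of_tendsto' (tendsto_setIntegral_of_monotone hmeas hmono hfi.integrableOn) fun n => ?_
  have hMi : Integrable (birkhoffMax T f n) μ :=
    Integrable.of_bound (measurable_birkhoffMax hT.measurable hf n).aestronglyMeasurable (n * C)
      (ae_of_all _ fun z => abs_birkhoffMax_le hC n z)
  have hMTi : Integrable (fun z => birkhoffMax T f n (T z)) μ := hT.integrable_comp_of_integrable hMi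
  have hinv : ∫ z, birkhoffMax T f n (T z) ∂μ = ∫ z, birkhoffMax T f n z ∂μ := by
    conv_rhs => rw [← hT.map_eq]
    rw [integral_map hT.measurable.aemeasurable
      (measurable_birkhoffMax hT.measurable hf n).aestronglyMeasurable]
  -- Integrate `f ≥ M - M ∘ T` over `{M > 0}`, with `M` the running maximum: all of `∫ M` is kept,
  -- while the part of `∫ M ∘ T` that is subtracted is at most `∫ M`.
  have h1 : ∫ z in {z | 0 < birkhoffMax T f n z}, birkhoffMax T f n z ∂μ
      = ∫ z, birkhoffMax T f n z ∂μ := by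
    refine setIntegral_eq_integral_of_forall_compl_eq_zero fun z hz => ?_
    exact le_antisymm (not_lt.1 hz) (birkhoffMax_nonneg f n z)
  have h2 : ∫ z in {z | 0 < birkhoffMax T f n z}, birkhoffMax T f n (T z) ∂μ
      ≤ ∫ z, birkhoffMax T f n (T z) ∂μ :=
    setIntegral_le_integral hMTi (ae_of_all _ fun z => birkhoffMax_nonneg f n _)
  have h3 : ∫ z in {z | 0 < birkhoffMax T f n z}, (birkhoffMax T f n z - birkhoffMax T f n (T z)) ∂μ
      ≤ ∫ z in {z | 0 < birkhoffMax T f n z}, f z ∂μ := by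
    refine setIntegral_mono_on (hMi.sub hMTi).integrableOn hfi.integrableOn (hmeas n) fun z hz => ?_
    have := birkhoffMax_le_of_pos f n z hz
    linarith
  rw [integral_sub hMi.integrableOn hMTi.integrableOn] at h3
  linarith

/-- The maximal ergodic inequality on an invariant set. -/
lemma setIntegral_nonneg_of_invariant [IsFiniteMeasure μ] (hT : MeasurePreserving T μ μ)
    {f : Ω → ℝ} (hf : Measurable f) {C : ℝ} (hC : ∀ z, |f z| ≤ C) {E : Set Ω}
    (hE : MeasurableSet E) (hinv : ∀ z, T z ∈ E ↔ z ∈ E)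
    (hpos : ∀ z ∈ E, ∃ n, 0 < birkhoffSum T f n z) : 0 ≤ ∫ z in E, f z ∂μ := by
  have hit : ∀ n z, T^[n] z ∈ E ↔ z ∈ E := fun n => by
    induction n with
    | zero => simp
    | succ n ih => intro z; rw [Function.iterate_succ_apply, ih, hinv]
  -- Invariance of `E` lets its indicator pass through Birkhoff sums, which reduces the claim to the
  -- unrestricted inequality for `E.indicator f`.
  have hsum : ∀ n z, birkhoffSum T (E.indicator f) n z = E.indicator (birkhoffSum T f n) z := by
    intro n z
    by_cases hz : z ∈ E
    · simp only [birkhoffSum, Set.indicator_of_mem hz]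
      exact Finset.sum_congr rfl fun j _ => Set.indicator_of_mem ((hit j z).2 hz) _
    · simp only [birkhoffSum, Set.indicator_of_notMem hz]
      exact Finset.sum_eq_zero fun j _ => Set.indicator_of_notMem (mt (hit j z).1 hz) _
  have hset : {z | ∃ n, 0 < birkhoffSum T (E.indicator f) n z} = E := by
    ext z
    simp only [Set.mem_ofPred_eq, hsum]
    refine ⟨fun ⟨n, hn⟩ => ?_, fun hz => ?_⟩
    · by_contra hz
      simp [Set.indicator_of_notMem hz] at hn
    · obtain ⟨n, hn⟩ := hpos z hz
      exact ⟨n, by rwa [Set.indicator_of_mem hz]⟩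
  have h := setIntegral_birkhoffSum_pos_nonneg hT (hf.indicator hE) (C := C) fun z => by
    by_cases hz : z ∈ E
    · simpa [Set.indicator_of_mem hz] using hC z
    · simpa [Set.indicator_of_notMem hz] using (abs_nonneg _).trans (hC z)
  rw [hset, setIntegral_indicator hE, Set.inter_self] at h
  exact h

/-- If the upper limit of the Birkhoff averages is almost surely at most the mean,
then the averages converge almost surely to the mean. -/
lemma ae_tendsto_birkhoffAverage_of_max [IsProbabilityMeasure μ] (hT : MeasurePreserving T μ μ)
    {f : Ω → ℝ} (hf : Measurable f) {C : ℝ} (hC : ∀ z, |f z| ≤ C) {c : ℝ} (hc : ∫ z, f z ∂μ = c)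
    (hmax : ∀ᵐ z ∂μ, Tendsto (fun n => max (birkhoffAverage ℝ T f n z) c) atTop (𝓝 c)) :
    ∀ᵐ z ∂μ, Tendsto (fun n => birkhoffAverage ℝ T f n z) atTop (𝓝 c) := by
  have hfi : Integrable f μ := Integrable.of_bound hf.aestronglyMeasurable C (ae_of_all _ hC)
  have havm : ∀ n, Measurable (birkhoffAverage ℝ T f n) := fun n =>
    (measurable_birkhoffSum hT.measurable hf n).const_smul ((n : ℝ)⁻¹)
  have havb : ∀ n z, |birkhoffAverage ℝ T f n z| ≤ C := fun n z => by
    have hC0 : 0 ≤ C := (abs_nonneg _).trans (hC z)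
    rw [birkhoffAverage, smul_eq_mul, abs_mul, abs_inv, Nat.abs_cast]
    rcases Nat.eq_zero_or_pos n with rfl | hn
    · simpa using hC0
    have hn' : (0 : ℝ) < n := by exact_mod_cast hn
    rw [inv_mul_le_iff₀ hn']
    exact abs_birkhoffSum_le hC n z
  have hlow : ∀ b < c, ∀ᵐ z ∂μ, ∀ k : ℕ, ∀ᶠ n in atTop,
      b - 1 / (k + 1) ≤ birkhoffAverage ℝ T f n z := by
    intro b hb
    -- The margins `1 / (k + 1)` make `E` invariant at every point: averages at `z` and `T z` differ
    -- by `o(1)`, which moving from `k` to `k + 1` absorbs.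
    set E : Set Ω := {z | ∃ k : ℕ, ∀ N : ℕ, ∃ n ≥ N, birkhoffAverage ℝ T f n z < b - 1 / (k + 1)}
      with hEdef
    have hE : MeasurableSet E := by
      have : E = ⋃ k : ℕ, ⋂ N : ℕ, ⋃ n ≥ N, {z | birkhoffAverage ℝ T f n z < b - 1 / (k + 1)} := by
        ext z; simp [hEdef]
      rw [this]
      exact MeasurableSet.iUnion fun k => MeasurableSet.iInter fun N => MeasurableSet.iUnion fun n =>
        MeasurableSet.iUnion fun _ => measurableSet_lt (havm n) measurable_const
    have hdiff : ∀ z, Tendsto (fun n => birkhoffAverage ℝ T f n (T z) - birkhoffAverage ℝ T f n z)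
        atTop (𝓝 0) := fun z =>
      tendsto_birkhoffAverage_apply_sub_birkhoffAverage' ℝ
        ((Metric.isBounded_closedBall (x := (0 : ℝ)) (r := C)).subset (by
          rintro _ ⟨z, rfl⟩
          simpa using hC z)) T z
    have htrans : ∀ u v : ℕ → ℝ, Tendsto (fun n => u n - v n) atTop (𝓝 0) →
        (∃ k : ℕ, ∀ N : ℕ, ∃ n ≥ N, v n < b - 1 / (k + 1)) →
        ∃ k : ℕ, ∀ N : ℕ, ∃ n ≥ N, u n < b - 1 / (k + 1) := by
      rintro u v huv ⟨k, hk⟩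
      have hpos : (0 : ℝ) < 1 / (k + 1) - 1 / ((k + 1 : ℕ) + 1) := by
        rw [sub_pos]
        apply one_div_lt_one_div_of_lt <;> push_cast <;> linarith [(Nat.cast_nonneg k : (0 : ℝ) ≤ k)]
      obtain ⟨N₀, hN₀⟩ := eventually_atTop.1 (huv.eventually_lt_const hpos)
      refine ⟨k + 1, fun N => ?_⟩
      obtain ⟨n, hn, hlt⟩ := hk (max N N₀)
      refine ⟨n, (le_max_left _ _).trans hn, ?_⟩
      have := hN₀ n ((le_max_right _ _).trans hn)
      linarith
    have hinv : ∀ z, T z ∈ E ↔ z ∈ E := fun z =>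
      ⟨htrans _ _ (by simpa using (hdiff z).neg), htrans _ _ (hdiff z)⟩
    have hposE : ∀ z ∈ E, ∃ n, 0 < birkhoffSum T (fun z => b - f z) n z := by
      rintro z ⟨k, hk⟩
      obtain ⟨n, hn, hlt⟩ := hk 1
      refine ⟨n, ?_⟩
      have hn' : (0 : ℝ) < n := by exact_mod_cast hn
      have h1 : birkhoffAverage ℝ T f n z < b := hlt.trans_le (by
        have : (0 : ℝ) < 1 / (k + 1) := by positivity
        linarith)
      rw [birkhoffAverage, smul_eq_mul, inv_mul_lt_iff₀ hn'] at h1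
      have h2 : birkhoffSum T (fun z => b - f z) n z = n * b - birkhoffSum T f n z := by
        simp [birkhoffSum]
      linarith
    -- The maximal inequality for `b - f` on `E` yields `∫_E f ≤ b * μ(E)`.
    have h1 : 0 ≤ ∫ z in E, (b - f z) ∂μ :=
      setIntegral_nonneg_of_invariant hT (hf.const_sub b) (C := |b| + C)
        (fun z => (abs_sub _ _).trans (by linarith [hC z])) hE hinv hposE
    rw [integral_sub (integrable_const b) hfi.integrableOn, setIntegral_const, smul_eq_mul] at h1
    -- On the invariant set `Eᶜ` the integral of `f` is that of each of its averages, hence at most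
    -- the integral of `max average c`, which tends to `c * μ(Eᶜ)`. The shift to order `n + 1`
    -- avoids the zero average of order `0`.
    have h2 : ∫ z in Eᶜ, f z ∂μ ≤ μ.real Eᶜ * c := by
      have hav : ∀ n : ℕ, ∫ z in Eᶜ, birkhoffAverage ℝ T f (n + 1) z ∂μ = ∫ z in Eᶜ, f z ∂μ := by
        intro n
        have hTE : MeasurePreserving T (μ.restrict Eᶜ) (μ.restrict Eᶜ) := by
          have := hT.restrict_preimage hE.compl
          rwa [show T ⁻¹' Eᶜ = Eᶜ from by ext z; simp [hinv]] at this
        simp only [birkhoffAverage, birkhoffSum, smul_eq_mul]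
        rw [integral_const_mul, integral_finsetSum _ fun j _ =>
          show Integrable (fun z => f (T^[j] z)) (μ.restrict Eᶜ) from
            (hTE.iterate j).integrable_comp_of_integrable hfi.integrableOn]
        have : ∀ j, ∫ z in Eᶜ, f (T^[j] z) ∂μ = ∫ z in Eᶜ, f z ∂μ := fun j => by
          conv_rhs => rw [← (hTE.iterate j).map_eq]
          rw [integral_map (hTE.iterate j).measurable.aemeasurable hf.aestronglyMeasurable]
        simp only [this, Finset.sum_const, Finset.card_range, nsmul_eq_mul]
        field_simp
      have hlim : Tendsto (fun n => ∫ z in Eᶜ, max (birkhoffAverage ℝ T f (n + 1) z) c ∂μ) atTop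
          (𝓝 (∫ z in Eᶜ, c ∂μ)) := by
        refine tendsto_integral_of_dominated_convergence (fun _ => C + |c|)
          (fun n => ((havm _).max measurable_const).aestronglyMeasurable) (integrable_const _)
          (fun n => ae_of_all _ fun z => ?_) ?_
        · refine (abs_max_le_max_abs_abs).trans (max_le ?_ ?_)
          · linarith [havb (n + 1) z, abs_nonneg c]
          · linarith [(abs_nonneg _).trans (hC z)]
        · filter_upwards [ae_restrict_of_ae hmax] with z hz
          exact hz.comp (tendsto_add_atTop_nat 1)
      rw [setIntegral_const, smul_eq_mul] at hlim
      refine ge_of_tendsto' hlim fun n => ?_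
      rw [← hav n]
      refine integral_mono ?_ ?_ fun z => le_max_left _ _
      · exact Integrable.of_bound (havm _).aestronglyMeasurable C (ae_of_all _ (havb _))
      · refine Integrable.of_bound ((havm _).max measurable_const).aestronglyMeasurable (C + |c|)
          (ae_of_all _ fun z => ?_)
        refine (abs_max_le_max_abs_abs).trans (max_le ?_ ?_)
        · linarith [havb (n + 1) z, abs_nonneg c]
        · linarith [(abs_nonneg _).trans (hC z)]
    have h3 : ∫ z in E, f z ∂μ + ∫ z in Eᶜ, f z ∂μ = c := by
      rw [integral_add_compl hE hfi, hc]
    have h4 : μ.real E + μ.real Eᶜ = 1 := by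
      rw [measureReal_add_measureReal_compl hE, probReal_univ]
    -- The two bounds give `c ≤ b * μ(E) + c * μ(Eᶜ)`, which for `b < c` forces `μ(E) = 0`.
    have h5 : μ.real E = 0 := by
      have h0 : 0 ≤ μ.real E := measureReal_nonneg
      have h7 : μ.real E * (c - b) ≤ 0 := by
        have : μ.real Eᶜ * c = c - μ.real E * c := by
          rw [eq_sub_of_add_eq' h4]; ring
        linarith
      exact le_antisymm (nonpos_of_mul_nonpos_left h7 (sub_pos.2 hb)) h0
    have h6 : μ E = 0 := by
      rwa [measureReal_eq_zero_iff] at h5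
    filter_upwards [measure_eq_zero_iff_ae_notMem.1 h6] with z hz
    simpa [hEdef, eventually_atTop] using hz
  have hall : ∀ᵐ z ∂μ, ∀ k : ℕ, ∀ j : ℕ, ∀ᶠ n in atTop,
      c - 1 / (k + 1) - 1 / (j + 1) ≤ birkhoffAverage ℝ T f n z :=
    ae_all_iff.2 fun k => hlow _ (by
      have : (0 : ℝ) < 1 / (k + 1) := by positivity
      linarith)
  filter_upwards [hall, hmax] with z hz hm
  refine tendsto_order.2 ⟨fun a ha => ?_, tendsto_max_iff_forall_gt.1 hm⟩
  obtain ⟨k, hk⟩ := exists_nat_one_div_lt (half_pos (sub_pos.2 ha))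
  filter_upwards [hz k k] with n hn
  linarith

end PointwiseErgodic

/-! ### Transition operator, stationary measures and the uniform upper bound. -/

section Stationary

variable {G X : Type*} [MeasurableSpace G] [TopologicalSpace X]

section Compact

variable [CompactSpace X]

lemma ContinuousMap.abs_apply_le_norm (f : C(X, ℝ)) (x : X) : |f x| ≤ ‖f‖ :=
  f.norm_coe_le_norm x

/-- Positivity is applied to `‖f‖ • 1 ± f`. The lemma serves both the powers of the transition
operator and their Cesàro means. -/
lemma abs_le_norm_of_nonneg_of_one {Λ : C(X, ℝ) →ₗ[ℝ] ℝ} (h : ∀ f, (∀ x, 0 ≤ f x) → 0 ≤ Λ f)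
    (h1 : Λ 1 = 1) (f : C(X, ℝ)) : |Λ f| ≤ ‖f‖ := by
  have e1 := h (‖f‖ • 1 - f) fun x => by
    simpa using (le_abs_self _).trans (f.abs_apply_le_norm x)
  have e2 := h (‖f‖ • 1 + f) fun x => by
    have := (neg_abs_le (f x))
    have := f.abs_apply_le_norm x
    simp only [ContinuousMap.add_apply, ContinuousMap.smul_apply, ContinuousMap.one_apply,
      smul_eq_mul, mul_one]
    linarith
  rw [map_sub, map_smul, h1, smul_eq_mul] at e1
  rw [map_add, map_smul, h1, smul_eq_mul] at e2
  exact abs_le.2 ⟨by linarith, by linarith⟩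

variable [MeasurableSpace X] [BorelSpace X]

lemma ContinuousMap.integrable_of_compact (f : C(X, ℝ)) (η : Measure X) [IsFiniteMeasure η] :
    Integrable f η :=
  Integrable.of_bound f.continuous.measurable.aestronglyMeasurable ‖f‖
    (ae_of_all _ f.abs_apply_le_norm)

end Compact

variable [MeasurableSpace X] [BorelSpace X] [SMul G X] [MeasurableSMul₂ G X]

lemma measurable_comp_smul (f : C(X, ℝ)) :
    Measurable (Function.uncurry fun (g : G) x => f (g • x)) :=
  f.continuous.measurable.comp (measurable_fst.smul measurable_snd)

lemma measurable_comp_smul_left (f : C(X, ℝ)) (x : X) : Measurable fun g : G => f (g • x) :=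
  (measurable_comp_smul f).comp measurable_prodMk_right

variable [CompactSpace X]

lemma integrable_comp_smul_left (ν : Measure G) [IsFiniteMeasure ν] (f : C(X, ℝ)) (x : X) :
    Integrable (fun g : G => f (g • x)) ν :=
  Integrable.of_bound (measurable_comp_smul_left f x).aestronglyMeasurable ‖f‖
    (ae_of_all _ fun _ => f.abs_apply_le_norm _)

variable [TopologicalSpace.MetrizableSpace X] [ContinuousConstSMul G X]

variable (ν : Measure G) [IsProbabilityMeasure ν]

/-- The transition operator `f ↦ ∫ f (g • x) dν(g)` of the random walk driven by `ν`. -/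
noncomputable def transition : C(X, ℝ) →ₗ[ℝ] C(X, ℝ) where
  toFun f := ⟨fun x => ∫ g, f (g • x) ∂ν, continuous_of_dominated (bound := fun _ => ‖f‖)
    (fun x => (measurable_comp_smul_left f x).aestronglyMeasurable)
    (fun _ => ae_of_all _ fun _ => f.abs_apply_le_norm _) (integrable_const _)
    (ae_of_all _ fun g => f.continuous.comp (continuous_const_smul g))⟩
  map_add' f h := by
    ext x
    exact integral_add (integrable_comp_smul_left ν f x) (integrable_comp_smul_left ν h x)
  map_smul' c f := by
    ext x
    exact integral_const_mul c _

lemma transition_apply (f : C(X, ℝ)) (x : X) : transition ν f x = ∫ g, f (g • x) ∂ν := rfl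

lemma transition_nonneg {f : C(X, ℝ)} (hf : ∀ x, 0 ≤ f x) (x : X) : 0 ≤ transition ν f x :=
  integral_nonneg fun _ => hf _

lemma transition_pow_nonneg (j : ℕ) {f : C(X, ℝ)} (hf : ∀ x, 0 ≤ f x) (x : X) :
    0 ≤ (transition ν ^ j) f x := by
  induction j generalizing x with
  | zero => exact hf x
  | succ j ih => rw [pow_succ']; exact transition_nonneg ν ih x

lemma transition_pow_one (j : ℕ) : (transition ν ^ j) (1 : C(X, ℝ)) = 1 := by
  induction j with
  | zero => rfl
  | succ j ih =>
    rw [pow_succ', Module.End.mul_apply, ih]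
    ext x
    simp [transition_apply]

/-- The Cesàro means of the powers of the transition operator. -/
noncomputable def transitionAvg (n : ℕ) : C(X, ℝ) →ₗ[ℝ] C(X, ℝ) :=
  ((n : ℝ) + 1)⁻¹ • ∑ j ∈ Finset.range (n + 1), transition ν ^ j

lemma transitionAvg_apply (n : ℕ) (f : C(X, ℝ)) (x : X) :
    transitionAvg ν n f x =
      ((n : ℝ) + 1)⁻¹ * ∑ j ∈ Finset.range (n + 1), (transition ν ^ j) f x := by
  simp [transitionAvg, LinearMap.sum_apply]

lemma transitionAvg_nonneg (n : ℕ) {f : C(X, ℝ)} (hf : ∀ x, 0 ≤ f x) (x : X) :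
    0 ≤ transitionAvg ν n f x := by
  rw [transitionAvg_apply]
  exact mul_nonneg (by positivity) (Finset.sum_nonneg fun j _ => transition_pow_nonneg ν j hf x)

lemma transitionAvg_one (n : ℕ) (x : X) : transitionAvg ν n (1 : C(X, ℝ)) x = 1 := by
  rw [transitionAvg_apply]
  simp only [transition_pow_one]
  simp
  field_simp

lemma abs_transition_pow_le (j : ℕ) (f : C(X, ℝ)) (x : X) : |(transition ν ^ j) f x| ≤ ‖f‖ :=
  abs_le_norm_of_nonneg_of_one
    (Λ := { toFun := fun f => (transition ν ^ j) f x
            map_add' := fun f h => by simp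
            map_smul' := fun c f => by simp })
    (fun f hf => transition_pow_nonneg ν j hf x) (by simp [transition_pow_one]) f

lemma abs_transitionAvg_le (n : ℕ) (f : C(X, ℝ)) (x : X) : |transitionAvg ν n f x| ≤ ‖f‖ :=
  abs_le_norm_of_nonneg_of_one
    (Λ := { toFun := fun f => transitionAvg ν n f x
            map_add' := fun f h => by simp
            map_smul' := fun c f => by simp })
    (fun f hf => transitionAvg_nonneg ν n hf x) (transitionAvg_one ν n x) f

/-- The difference of the two Cesàro means telescopes to its end terms; this asymptotic invariance
is what makes limits of Cesàro means stationary. -/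
lemma abs_transitionAvg_transition_sub_le (n : ℕ) (f : C(X, ℝ)) (x : X) :
    |transitionAvg ν n (transition ν f) x - transitionAvg ν n f x| ≤ 2 * ‖f‖ / (n + 1) := by
  have h : transitionAvg ν n (transition ν f) x - transitionAvg ν n f x =
      ((n : ℝ) + 1)⁻¹ * ((transition ν ^ (n + 1)) f x - f x) := by
    rw [transitionAvg_apply, transitionAvg_apply, ← mul_sub, ← Finset.sum_sub_distrib]
    congr 1
    have := Finset.sum_range_sub (fun j => (transition ν ^ j) f x) (n + 1)
    simpa [pow_succ] using this
  rw [h, abs_mul, abs_of_pos (by positivity : (0 : ℝ) < ((n : ℝ) + 1)⁻¹), inv_mul_eq_div]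
  gcongr
  refine (abs_sub _ _).trans ?_
  linarith [abs_transition_pow_le ν (n + 1) f x, f.abs_apply_le_norm x]

/-- `η` is a `ν`-stationary probability measure. -/
def IsStationaryMeasure (η : Measure X) : Prop :=
  IsProbabilityMeasure η ∧ (ν.prod η).map (fun z : G × X => z.1 • z.2) = η

lemma integral_map_smul (η : Measure X) [IsFiniteMeasure η] (f : C(X, ℝ)) :
    ∫ x, f x ∂((ν.prod η).map fun z : G × X => z.1 • z.2) = ∫ x, transition ν f x ∂η := by
  rw [integral_map (φ := fun z : G × X => z.1 • z.2)
    (measurable_fst.smul measurable_snd).aemeasurable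
    f.continuous.measurable.aestronglyMeasurable]
  exact integral_prod_symm (fun z : G × X => f (z.1 • z.2))
    (Integrable.of_bound (measurable_comp_smul f).aestronglyMeasurable ‖f‖
      (ae_of_all _ fun _ => f.abs_apply_le_norm _))

variable {ν} in
lemma IsStationaryMeasure.integral_transition {η : Measure X} (hη : IsStationaryMeasure ν η) (f : C(X, ℝ)) :
    ∫ x, transition ν f x ∂η = ∫ x, f x ∂η := by
  have := hη.1
  rw [← integral_map_smul, hη.2]

variable {ν} in
lemma IsStationaryMeasure.integral_transitionAvg {η : Measure X} (hη : IsStationaryMeasure ν η) (n : ℕ)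
    (f : C(X, ℝ)) : ∫ x, transitionAvg ν n f x ∂η = ∫ x, f x ∂η := by
  have := hη.1
  have hp : ∀ j, ∫ x, (transition ν ^ j) f x ∂η = ∫ x, f x ∂η := fun j => by
    induction j with
    | zero => rfl
    | succ j ih => rw [pow_succ', Module.End.mul_apply, hη.integral_transition, ih]
  simp only [transitionAvg_apply]
  rw [integral_const_mul, integral_finsetSum _ fun j _ => ContinuousMap.integrable_of_compact _ η]
  simp only [hp, Finset.sum_const, Finset.card_range, nsmul_eq_mul]
  push_cast
  field_simp

/-- Limits of Cesàro means along an ultrafilter are integrals against stationary measures. -/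
lemma exists_isStationary_tendsto (x : ℕ → X) :
    ∃ η : Measure X, IsStationaryMeasure ν η ∧ ∀ f : C(X, ℝ),
      Tendsto (fun n => transitionAvg ν n f (x n)) (hyperfilter ℕ) (𝓝 (∫ y, f y ∂η)) := by
  -- Each numerical sequence is bounded, so it converges along the ultrafilter; one ultrafilter
  -- serves all `f` at once and makes the limits linear in `f`.
  have hex : ∀ f : C(X, ℝ), ∃ a, Tendsto (fun n => transitionAvg ν n f (x n)) (hyperfilter ℕ) (𝓝 a) := by
    intro f
    obtain ⟨a, -, ha⟩ := (isCompact_Icc (a := -‖f‖) (b := ‖f‖)).ultrafilter_le_nhds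
      ((hyperfilter ℕ).map fun n => transitionAvg ν n f (x n)) (by
        rw [le_principal_iff]
        exact Eventually.of_forall (f := (hyperfilter ℕ : Filter ℕ))
          fun n => abs_le.1 (abs_transitionAvg_le ν n f (x n)))
    exact ⟨a, ha⟩
  choose Λ hΛ using hex
  have hpos : ∀ f : C(X, ℝ), (∀ x, 0 ≤ f x) → 0 ≤ Λ f := fun f hf =>
    ge_of_tendsto' (hΛ f) fun n => transitionAvg_nonneg ν n hf _
  let L : CompactlySupportedContinuousMap X ℝ →ₚ[ℝ] ℝ := PositiveLinearMap.mk₀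
    { toFun := fun f => Λ f.toContinuousMap
      map_add' := fun f h => tendsto_nhds_unique (hΛ _) (by
        have := (hΛ f.toContinuousMap).add (hΛ h.toContinuousMap)
        refine this.congr fun n => ?_
        rw [← ContinuousMap.add_apply, ← map_add]; rfl)
      map_smul' := fun c f => tendsto_nhds_unique (hΛ _) (by
        have := (hΛ f.toContinuousMap).const_mul c
        refine this.congr fun n => ?_
        rw [← smul_eq_mul, ← ContinuousMap.smul_apply, ← map_smul]; rfl) }
    (fun f hf => hpos _ hf)
  set η := RealRMK.rieszMeasure L
  have hint : ∀ f : C(X, ℝ), ∫ y, f y ∂η = Λ f := fun f =>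
    RealRMK.integral_rieszMeasure L (CompactlySupportedContinuousMap.continuousMapEquiv f)
  have hfin : IsFiniteMeasure η := inferInstance
  have hprob : IsProbabilityMeasure η := by
    have h1 := hint 1
    have h2 : Λ 1 = 1 := tendsto_nhds_unique (hΛ 1) (by
      simp only [transitionAvg_one]; exact tendsto_const_nhds)
    rw [h2] at h1
    simp only [ContinuousMap.one_apply, integral_const, smul_eq_mul, mul_one] at h1
    exact ⟨by rwa [measureReal_def, ENNReal.toReal_eq_one_iff] at h1⟩
  refine ⟨η, ⟨hprob, ?_⟩, fun f => by rw [hint]; exact hΛ f⟩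
  have : IsProbabilityMeasure ((ν.prod η).map fun z : G × X => z.1 • z.2) :=
    Measure.isProbabilityMeasure_map (measurable_fst.smul measurable_snd).aemeasurable
  let := TopologicalSpace.metrizableSpaceMetric X
  refine ext_of_forall_integral_eq_of_IsFiniteMeasure fun f => ?_
  rw [show (f : X → ℝ) = f.toContinuousMap from rfl, integral_map_smul, hint, hint]
  refine tendsto_nhds_unique (hΛ _) ?_
  have h0 : Tendsto (fun n : ℕ => transitionAvg ν n (transition ν f.toContinuousMap) (x n)
      - transitionAvg ν n f.toContinuousMap (x n)) (hyperfilter ℕ) (𝓝 0) := by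
    refine squeeze_zero_norm (fun n => abs_transitionAvg_transition_sub_le ν n _ _) ?_
    refine Tendsto.mono_left ?_ (Nat.hyperfilter_le_atTop)
    exact (tendsto_atTop_add_const_right _ 1 tendsto_natCast_atTop_atTop).const_div_atTop _
  simpa using h0.add (hΛ f.toContinuousMap)

/-- The integrals of `φ` against stationary measures have a maximum, which is approximated from
above, uniformly in the starting point, by Cesàro means. -/
lemma exists_isGreatest_integral [Nonempty X] (φ : C(X, ℝ)) :
    ∃ c, IsGreatest {a | ∃ η : Measure X, IsStationaryMeasure ν η ∧ ∫ x, φ x ∂η = a} c ∧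
      ∀ b > c, ∃ n, ∀ x, transitionAvg ν n φ x < b := by
  -- Starting the `n`-th mean at its maximum point makes the limiting measure see the suprema; the
  -- maximum over stationary measures is the infimum of these suprema over `n`.
  have hmax : ∀ n, ∃ x, ∀ y, transitionAvg ν n φ y ≤ transitionAvg ν n φ x := fun n => by
    obtain ⟨x, -, hx⟩ := isCompact_univ.exists_isMaxOn Set.univ_nonempty
      (transitionAvg ν n φ).continuous.continuousOn
    exact ⟨x, fun y => hx (Set.mem_univ y)⟩
  choose x hx using hmax
  have hbdd : BddBelow (Set.range fun n => transitionAvg ν n φ (x n)) :=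
    ⟨-‖φ‖, by rintro _ ⟨n, rfl⟩; exact (abs_le.1 (abs_transitionAvg_le ν n φ (x n))).1⟩
  obtain ⟨η, hη, hlim⟩ := exists_isStationary_tendsto ν x
  -- Integrals against a stationary measure do not change under Cesàro means, so they lie below
  -- every supremum.
  have hle : ∀ η : Measure X, IsStationaryMeasure ν η → ∫ y, φ y ∂η ≤ ⨅ n, transitionAvg ν n φ (x n) := by
    intro η hη
    have := hη.1
    refine le_ciInf fun n => ?_
    rw [← hη.integral_transitionAvg n]
    refine (integral_mono (ContinuousMap.integrable_of_compact _ η) (integrable_const _)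
      (hx n)).trans ?_
    simp
  have hge : ⨅ n, transitionAvg ν n φ (x n) ≤ ∫ y, φ y ∂η :=
    ge_of_tendsto' (hlim φ) fun n => ciInf_le hbdd n
  refine ⟨⨅ n, transitionAvg ν n φ (x n), ⟨⟨η, hη, le_antisymm (hle η hη) hge⟩, ?_⟩, fun b hb => ?_⟩
  · rintro _ ⟨η, hη, rfl⟩
    exact hle η hη
  · obtain ⟨n, hn⟩ := exists_lt_of_ciInf_lt hb
    exact ⟨n, fun y => (hx n y).trans_lt hn⟩

/-- The sum is a sum of centred increments `f (x_{j+1}) - P f (x_j)`, with `P` the transition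
operator, plus the bounded telescoping term `f (x_0) - f (x_n)`. -/
lemma ae_tendsto_orbitSum_sub_transition (f : C(X, ℝ)) (x : X) :
    ∀ᵐ ω ∂(Measure.infinitePi fun _ : ℕ => ν),
      Tendsto (fun n : ℕ => orbitSum (fun (_ : G) y => f y - transition ν f y) n ω x / n)
        atTop (𝓝 0) := by
  have h := ae_tendsto_orbitSum_div ν (F := fun g y => f (g • y) - transition ν f y)
    ((measurable_comp_smul f).sub ((transition ν f).continuous.measurable.comp measurable_snd))
    (C := ‖f‖ + ‖transition ν f‖)
    (fun g y => (abs_sub _ _).trans (add_le_add (f.abs_apply_le_norm _)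
      ((transition ν f).abs_apply_le_norm _)))
    (fun y => by
      rw [integral_sub (integrable_comp_smul_left ν f y) (integrable_const _)]
      simp [transition_apply]) x
  filter_upwards [h] with ω hω
  have hb : Tendsto (fun n : ℕ => (f x - f (randomOrbit ω x n)) / n) atTop (𝓝 0) := by
    refine squeeze_zero_norm (a := fun n : ℕ => 2 * ‖f‖ / n) (fun n => ?_)
      (tendsto_natCast_atTop_atTop.const_div_atTop _)
    rw [norm_div, Real.norm_natCast]
    gcongr
    refine (abs_sub _ _).trans ?_
    linarith [f.abs_apply_le_norm x, f.abs_apply_le_norm (randomOrbit ω x n)]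
  have := hω.add hb
  rw [add_zero] at this
  refine this.congr fun n => ?_
  rw [← add_div]
  congr 1
  have ht := Finset.sum_range_sub (fun j => f (randomOrbit ω x j)) n
  simp only [orbitSum, Finset.sum_sub_distrib, randomOrbit_succ, randomOrbit_zero] at ht ⊢
  linarith

/-- Write `f - P ^ j f` as a telescoping sum of `P ^ i f - P ^ (i + 1) f`, with `P` the transition
operator. A single null set serves all `j`. -/
lemma ae_tendsto_orbitSum_sub_transition_pow (f : C(X, ℝ)) (x : X) :
    ∀ᵐ ω ∂(Measure.infinitePi fun _ : ℕ => ν), ∀ j : ℕ,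
      Tendsto (fun n : ℕ => orbitSum (fun (_ : G) y => f y - (transition ν ^ j) f y) n ω x / n)
        atTop (𝓝 0) := by
  filter_upwards [ae_all_iff.2 fun j =>
    ae_tendsto_orbitSum_sub_transition ν ((transition ν ^ j) f) x] with ω hω j
  induction j with
  | zero => simp [orbitSum]
  | succ j ih =>
    have := ih.add (hω j)
    rw [add_zero] at this
    refine this.congr fun n => ?_
    rw [← add_div, pow_succ', Module.End.mul_apply]
    congr 1
    simp only [orbitSum_sub]
    ring

lemma ae_tendsto_orbitSum_sub_transitionAvg (f : C(X, ℝ)) (x : X) :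
    ∀ᵐ ω ∂(Measure.infinitePi fun _ : ℕ => ν), ∀ k : ℕ,
      Tendsto (fun n : ℕ => orbitSum (fun (_ : G) y => f y - transitionAvg ν k f y) n ω x / n)
        atTop (𝓝 0) := by
  filter_upwards [ae_tendsto_orbitSum_sub_transition_pow ν f x] with ω hω k
  have h := (tendsto_finsetSum (Finset.range (k + 1)) fun j _ => hω j).const_mul ((k : ℝ) + 1)⁻¹
  rw [Finset.sum_const_zero, mul_zero] at h
  refine h.congr fun n => ?_
  rw [← Finset.sum_div, ← mul_div_assoc]
  congr 1
  simp only [orbitSum, transitionAvg_apply]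
  rw [Finset.sum_comm, Finset.mul_sum]
  refine Finset.sum_congr rfl fun i _ => ?_
  rw [Finset.sum_sub_distrib, mul_sub, Finset.sum_const, Finset.card_range, nsmul_eq_mul]
  congr 1
  push_cast
  field_simp

/-- Along every random orbit the upper averages are almost surely at most the maximal integral
against a stationary measure. -/
lemma ae_tendsto_max_orbitSum {F : G → X → ℝ} (hF : Measurable (Function.uncurry F)) {C : ℝ}
    (hC : ∀ g x, |F g x| ≤ C) (φ : C(X, ℝ)) (hφ : ∀ x, φ x = ∫ g, F g x ∂ν) {c : ℝ}
    (hc : ∀ b > c, ∃ n, ∀ x, transitionAvg ν n φ x < b) (x : X) :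
    ∀ᵐ ω ∂(Measure.infinitePi fun _ : ℕ => ν),
      Tendsto (fun n : ℕ => max (orbitSum F n ω x / n) c) atTop (𝓝 c) := by
  have h := ae_tendsto_orbitSum_div ν (F := fun g y => F g y - φ y)
    (hF.sub (φ.continuous.measurable.comp measurable_snd)) (C := C + ‖φ‖)
    (fun g y => (abs_sub _ _).trans (add_le_add (hC _ _) (φ.abs_apply_le_norm _)))
    (fun y => by
      rw [integral_sub _ (integrable_const _)]
      · simp [hφ]
      · exact Integrable.of_bound (hF.comp measurable_prodMk_right).aestronglyMeasurable C
          (ae_of_all _ fun g => hC g y)) x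
  filter_upwards [h, ae_tendsto_orbitSum_sub_transitionAvg ν φ x] with ω h1 h2
  rw [tendsto_max_iff_forall_gt]
  intro b hb
  obtain ⟨b', hb', hb'b⟩ := exists_between hb
  obtain ⟨k, hk⟩ := hc b' hb'
  have h3 := h1.add (h2 k)
  rw [add_zero] at h3
  -- The replacement of `F` by the `k`-th Cesàro mean costs `o(n)`, eventually less than `n * (b -
  -- b')`, and that mean is below `b'` everywhere.
  filter_upwards [h3.eventually_lt_const (sub_pos.2 hb'b), eventually_ge_atTop 1] with n hn hn1
  have hn' : (0 : ℝ) < n := by exact_mod_cast hn1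
  have h4 : orbitSum (fun (_ : G) y => transitionAvg ν k φ y) n ω x ≤ n * b' := by
    refine (Finset.sum_le_sum fun j _ => (hk _).le).trans ?_
    simp
  rw [orbitSum_sub, orbitSum_sub, ← add_div, div_lt_iff₀ hn'] at hn
  rw [div_lt_iff₀ hn']
  nlinarith

end Stationary

/-! ### Topology of projective space. -/

section ProjectiveSpace

variable {d m : ℕ}

/-- Second countability, carried up to `QPCocycle`, makes the product of Borel σ-algebras Borel, so
that continuous maps on products are measurable. -/
instance : SecondCountableTopology (Matrix (Fin m) (Fin m) ℝ) :=
  inferInstanceAs (SecondCountableTopology (Fin m → Fin m → ℝ))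

instance : SecondCountableTopology (Matrix.SpecialLinearGroup (Fin m) ℝ) :=
  (IsEmbedding.subtypeVal (p := fun A : Matrix (Fin m) (Fin m) ℝ =>
    A.det = 1)).secondCountableTopology

instance : SecondCountableTopology (QPCocycle d m) :=
  inferInstanceAs (SecondCountableTopology
    (UnitAddTorus (Fin d) × C(UnitAddTorus (Fin d), Matrix.SpecialLinearGroup (Fin m) ℝ)))

lemma ofLp_ne_zero {w : EuclideanSpace ℝ (Fin m)} (hw : w ≠ 0) : w.ofLp ≠ 0 := by
  simpa using hw

/-- The projective class of a nonzero Euclidean vector. -/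
noncomputable def projClass (w : EuclideanSpace ℝ (Fin m)) (hw : w ≠ 0) : ProjSpace m :=
  Projectivization.mk ℝ w.ofLp (ofLp_ne_zero hw)

lemma continuous_projClass :
    Continuous fun w : {w : EuclideanSpace ℝ (Fin m) // w ≠ 0} => projClass w.1 w.2 := by
  have h : Continuous fun v : {v : Fin m → ℝ // v ≠ 0} =>
      (Quotient.mk (projectivizationSetoid ℝ (Fin m → ℝ)) v) := continuous_quotient_mk'
  exact h.comp (Continuous.subtype_mk ((PiLp.continuous_ofLp 2 _).comp continuous_subtype_val)
    fun w => ofLp_ne_zero w.2)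

lemma Projectivization.exists_projClass_eq (x : ProjSpace m) : ∃ w hw, projClass w hw = x :=
  ⟨WithLp.toLp 2 x.rep, by simpa using x.rep_nonzero, x.mk_rep⟩

lemma projClass_smul {a : ℝ} (ha : a ≠ 0) (w : EuclideanSpace ℝ (Fin m)) (hw : w ≠ 0) :
    projClass (a • w) (smul_ne_zero ha hw) = projClass w hw :=
  (Projectivization.mk_eq_mk_iff' ℝ _ _ _ _).2 ⟨a, rfl⟩

/-- The projection of the unit sphere onto projective space. -/
noncomputable def sphereProj (s : Metric.sphere (0 : EuclideanSpace ℝ (Fin m)) 1) : ProjSpace m :=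
  projClass s.1 (ne_zero_of_mem_unit_sphere s)

lemma continuous_sphereProj : Continuous (sphereProj (m := m)) :=
  continuous_projClass.comp (Continuous.subtype_mk continuous_subtype_val
    fun s => ne_zero_of_mem_unit_sphere s)

lemma surjective_sphereProj : Function.Surjective (sphereProj (m := m)) := fun x => by
  obtain ⟨w, hw, rfl⟩ := x.exists_projClass_eq
  have hw' : ‖w‖ ≠ 0 := norm_ne_zero_iff.2 hw
  refine ⟨⟨‖w‖⁻¹ • w, ?_⟩, projClass_smul (inv_ne_zero hw') w hw⟩
  simp [norm_smul, hw']

instance : CompactSpace (ProjSpace m) :=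
  surjective_sphereProj.compactSpace continuous_sphereProj

/-- The embedding of projective space into matrices, by the orthogonal projection onto a line. -/
noncomputable def lineProjection : ProjSpace m → Fin m → Fin m → ℝ :=
  Quotient.lift (fun v : {v : Fin m → ℝ // v ≠ 0} => fun i j => v.1 i * v.1 j / ∑ k, v.1 k ^ 2) (by
    rintro v w ⟨a, ha⟩
    have ha' : v.1 = (a : ℝ) • w.1 := ha.symm
    have ha0 : (a : ℝ) ≠ 0 := a.ne_zero
    ext i j
    simp only [ha', Pi.smul_apply, smul_eq_mul, mul_pow, ← Finset.mul_sum]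
    rw [show (a : ℝ) * w.1 i * (a * w.1 j) = a ^ 2 * (w.1 i * w.1 j) by ring,
      mul_div_mul_left _ _ (pow_ne_zero 2 ha0)])

lemma sum_sq_pos {v : Fin m → ℝ} (hv : v ≠ 0) : 0 < ∑ k, v k ^ 2 := by
  obtain ⟨i, hi⟩ := Function.ne_iff.1 hv
  exact Finset.sum_pos' (fun k _ => sq_nonneg _) ⟨i, Finset.mem_univ i, by
    have : v i ≠ 0 := hi
    positivity⟩

lemma continuous_lineProjection : Continuous (lineProjection (m := m)) := by
  refine Continuous.quotient_lift ?_ _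
  have hc : ∀ i, Continuous fun v : {v : Fin m → ℝ // v ≠ 0} => v.1 i := fun i =>
    (continuous_apply i).comp continuous_subtype_val
  exact continuous_pi fun i => continuous_pi fun j => ((hc i).mul (hc j)).div
    (continuous_finsetSum _ fun k _ => (hc k).pow 2) fun v => (sum_sq_pos v.2).ne'

/-- A column of the projection matrix with nonzero index entry `v j` is a nonzero multiple of `v`,
so the matrix determines the line. -/
lemma injective_lineProjection : Function.Injective (lineProjection (m := m)) := by
  intro x y
  induction x using Quotient.inductionOn with | h v => ?_
  induction y using Quotient.inductionOn with | h w => ?_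
  intro h
  have h' : ∀ i j, v.1 i * v.1 j / ∑ k, v.1 k ^ 2 = w.1 i * w.1 j / ∑ k, w.1 k ^ 2 :=
    fun i j => congrFun (congrFun h i) j
  have hv := sum_sq_pos v.2
  have hw := sum_sq_pos w.2
  obtain ⟨j, hj⟩ := Function.ne_iff.1 v.2
  have hj : v.1 j ≠ 0 := hj
  refine (Projectivization.mk_eq_mk_iff' ℝ v.1 w.1 v.2 w.2).2
    ⟨w.1 j * (∑ k, v.1 k ^ 2) / ((∑ k, w.1 k ^ 2) * v.1 j), ?_⟩
  ext i
  have := h' i j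
  rw [div_eq_div_iff hv.ne' hw.ne'] at this
  simp only [Pi.smul_apply, smul_eq_mul]
  field_simp
  linarith

instance : T2Space (ProjSpace m) :=
  T2Space.of_injective_continuous injective_lineProjection continuous_lineProjection

instance : TopologicalSpace.MetrizableSpace (ProjSpace m) :=
  (continuous_lineProjection.isClosedEmbedding injective_lineProjection).isEmbedding.metrizableSpace

instance : SecondCountableTopology (ProjSpace m) :=
  (continuous_lineProjection.isClosedEmbedding
    injective_lineProjection).isEmbedding.secondCountableTopology

/-- A product with a quotient map need not be a quotient map, but `sphereProj` is proper, so its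
product with an identity is closed. Joint continuity of `psi` and of the action can thus be checked
on unit vectors, although the space of cocycles is not compact. -/
lemma isQuotientMap_prodMap_sphereProj (Y : Type*) [TopologicalSpace Y] :
    IsQuotientMap (Prod.map (id : Y → Y) (sphereProj (m := m))) :=
  ((isProperMap_id.prodMap continuous_sphereProj.isProperMap).isClosedMap).isQuotientMap
    (continuous_id.prodMap continuous_sphereProj) (Function.surjective_id.prodMap surjective_sphereProj)

lemma nonempty_projSpace (hm : 1 ≤ m) : Nonempty (ProjSpace m) :=
  ⟨projClass (EuclideanSpace.single ⟨0, hm⟩ 1) (by simp)⟩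

end ProjectiveSpace

/-! ### The action on projective space and the additive cocycle `psi`. -/

namespace QPCocycle

variable {d m : ℕ}

lemma continuous_op : Continuous fun p : QPCocycle d m × UnitAddTorus (Fin d) => p.1.op p.2 := by
  have h1 : Continuous fun A : Matrix (Fin m) (Fin m) ℝ => Matrix.toEuclideanCLM (𝕜 := ℝ) A :=
    LinearMap.continuous_of_finiteDimensional
      (Matrix.toEuclideanCLM (𝕜 := ℝ) (n := Fin m)).toAlgEquiv.toLinearMap
  have h2 : Continuous fun p : QPCocycle d m × UnitAddTorus (Fin d) => p.1.mat p.2 :=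
    continuous_eval.comp ((continuous_snd.comp continuous_fst).prodMk continuous_snd)
  exact h1.comp (continuous_subtype_val.comp h2)

lemma _root_.Continuous.op {Y : Type*} [TopologicalSpace Y] {g : Y → QPCocycle d m}
    {θ : Y → UnitAddTorus (Fin d)} (hg : Continuous g) (hθ : Continuous θ) :
    Continuous fun y => (g y).op (θ y) :=
  Continuous.comp (g := fun p : QPCocycle d m × UnitAddTorus (Fin d) => p.1.op p.2)
    (f := fun y => (g y, θ y)) continuous_op (hg.prodMk hθ)

lemma continuous_freq : Continuous (freq : QPCocycle d m → UnitAddTorus (Fin d)) :=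
  continuous_fst

lemma op_mul (g h : QPCocycle d m) (θ : UnitAddTorus (Fin d)) :
    (g * h).op θ = g.op (θ + h.freq) * h.op θ := by
  simp [op]

lemma op_one (θ : UnitAddTorus (Fin d)) : (1 : QPCocycle d m).op θ = 1 := by
  simp [op]

lemma op_ne_zero (g : QPCocycle d m) (θ : UnitAddTorus (Fin d)) {w : EuclideanSpace ℝ (Fin m)}
    (hw : w ≠ 0) : g.op θ w ≠ 0 := by
  intro h
  have h1 : (g⁻¹ * g).op θ w = 0 := by
    rw [op_mul, mul_apply_eq_comp, h, map_zero]
  rw [inv_mul_cancel, op_one] at h1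
  exact hw h1

lemma smul_projClass (g : QPCocycle d m) (θ : UnitAddTorus (Fin d)) (w : EuclideanSpace ℝ (Fin m))
    (hw : w ≠ 0) :
    g • ((θ, projClass w hw) : TorusProj d m)
      = (θ + g.freq, projClass (g.op θ w) (op_ne_zero g θ hw)) := by
  rw [smul_def]
  refine Prod.ext rfl ?_
  exact Projectivization.smul_mk _ _

/-- The chosen representative only changes numerator and denominator by the same scalar. In this
form `psi` is a difference of logarithms and telescopes along orbits. -/
lemma psi_projClass (g : QPCocycle d m) (θ : UnitAddTorus (Fin d)) (w : EuclideanSpace ℝ (Fin m))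
    (hw : w ≠ 0) : psi g (θ, projClass w hw) = Real.log ‖g.op θ w‖ - Real.log ‖w‖ := by
  obtain ⟨a, ha⟩ := Projectivization.exists_smul_eq_mk_rep ℝ w.ofLp (ofLp_ne_zero hw)
  have ha0 : (a : ℝ) ≠ 0 := a.ne_zero
  have hrep : (projClass w hw).rep = (a : ℝ) • w.ofLp := ha.symm
  have h1 : WithLp.toLp 2 (projClass w hw).rep = (a : ℝ) • w := by rw [hrep]; rfl
  have hw0 : ‖w‖ ≠ 0 := norm_ne_zero_iff.2 hw
  have ho : ‖g.op θ w‖ ≠ 0 := norm_ne_zero_iff.2 (op_ne_zero g θ hw)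
  have hn : ‖(a : ℝ)‖ ≠ 0 := norm_ne_zero_iff.2 ha0
  simp only [psi, h1, map_smul, norm_smul, norm_inv, norm_mul, norm_norm]
  rw [← Real.log_div ho hw0]
  congr 1
  field_simp

lemma continuous_psi : Continuous fun z : QPCocycle d m × TorusProj d m => psi z.1 z.2 := by
  have h : Continuous fun z : (QPCocycle d m × UnitAddTorus (Fin d)) × ProjSpace m =>
      psi z.1.1 (z.1.2, z.2) := by
    rw [(isQuotientMap_prodMap_sphereProj _).continuous_iff]
    have e : (fun z : (QPCocycle d m × UnitAddTorus (Fin d)) × ProjSpace m =>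
        psi z.1.1 (z.1.2, z.2)) ∘ Prod.map id sphereProj =
        fun z : (QPCocycle d m × UnitAddTorus (Fin d)) ×
          Metric.sphere (0 : EuclideanSpace ℝ (Fin m)) 1 => Real.log ‖z.1.1.op z.1.2 z.2.1‖ := by
      ext z
      simp [sphereProj, psi_projClass]
    rw [e]
    refine Continuous.log ?_ fun z =>
      norm_ne_zero_iff.2 (op_ne_zero z.1.1 z.1.2 (ne_zero_of_mem_unit_sphere z.2))
    exact ((Continuous.op (by fun_prop) (by fun_prop)).clm_apply
      (continuous_subtype_val.comp continuous_snd)).norm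
  have hc : Continuous fun z : QPCocycle d m × TorusProj d m => ((z.1, z.2.1), z.2.2) :=
    (continuous_fst.prodMk (continuous_fst.comp continuous_snd)).prodMk
      (continuous_snd.comp continuous_snd)
  simpa only [Function.comp_def, Prod.mk.eta] using h.comp hc

instance : ContinuousSMul (QPCocycle d m) (TorusProj d m) := by
  have h : Continuous fun z : (QPCocycle d m × UnitAddTorus (Fin d)) × ProjSpace m =>
      z.1.1 • ((z.1.2, z.2) : TorusProj d m) := by
    rw [(isQuotientMap_prodMap_sphereProj _).continuous_iff]
    have e : (fun z : (QPCocycle d m × UnitAddTorus (Fin d)) × ProjSpace m =>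
        z.1.1 • ((z.1.2, z.2) : TorusProj d m)) ∘ Prod.map id sphereProj =
        fun z : (QPCocycle d m × UnitAddTorus (Fin d)) ×
          Metric.sphere (0 : EuclideanSpace ℝ (Fin m)) 1 => (z.1.2 + z.1.1.freq, projClass (z.1.1.op z.1.2 z.2.1)
          (op_ne_zero _ _ (ne_zero_of_mem_unit_sphere z.2))) := by
      ext1 z
      exact smul_projClass z.1.1 z.1.2 z.2.1 (ne_zero_of_mem_unit_sphere z.2)
    rw [e]
    refine Continuous.prodMk ?_ ?_
    · exact (continuous_snd.comp continuous_fst).add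
        (continuous_freq.comp (continuous_fst.comp continuous_fst))
    · exact continuous_projClass.comp (Continuous.subtype_mk
        ((Continuous.op (by fun_prop) (by fun_prop)).clm_apply
          (continuous_subtype_val.comp continuous_snd))
        fun z => op_ne_zero z.1.1 z.1.2 (ne_zero_of_mem_unit_sphere z.2))
  have hc : Continuous fun z : QPCocycle d m × TorusProj d m => ((z.1, z.2.1), z.2.2) :=
    (continuous_fst.prodMk (continuous_fst.comp continuous_snd)).prodMk
      (continuous_snd.comp continuous_snd)
  exact ⟨h.comp hc⟩

instance : MeasurableSMul₂ (QPCocycle d m) (TorusProj d m) :=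
  ⟨continuous_smul.measurable⟩

lemma iterOp_zero (ω : ℕ → QPCocycle d m) (θ : UnitAddTorus (Fin d)) : iterOp ω 0 θ = 1 :=
  op_one θ

lemma iterOp_succ (ω : ℕ → QPCocycle d m) (n : ℕ) (θ : UnitAddTorus (Fin d)) :
    iterOp ω (n + 1) θ = (ω n).op (θ + (iter ω n).freq) * iterOp ω n θ :=
  op_mul _ _ _

lemma continuous_iterOp (n : ℕ) :
    Continuous fun p : (ℕ → QPCocycle d m) × UnitAddTorus (Fin d) => iterOp p.1 n p.2 := by
  have hf : ∀ n, Continuous fun p : (ℕ → QPCocycle d m) × UnitAddTorus (Fin d) =>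
      (iter p.1 n).freq := fun n => by
    induction n with
    | zero => exact continuous_const
    | succ n ih =>
      have h : Continuous fun p : (ℕ → QPCocycle d m) × UnitAddTorus (Fin d) => p.1 n := by fun_prop
      exact (continuous_freq.comp h).add ih
  induction n with
  | zero => simp only [iterOp_zero]; exact continuous_const
  | succ n ih =>
    simp only [iterOp_succ]
    have h : Continuous fun p : (ℕ → QPCocycle d m) × UnitAddTorus (Fin d) => p.1 n := by fun_prop
    exact (h.op (continuous_snd.add (hf n))).mul ih

lemma iterOp_ne_zero (ω : ℕ → QPCocycle d m) (n : ℕ) (θ : UnitAddTorus (Fin d))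
    {w : EuclideanSpace ℝ (Fin m)} (hw : w ≠ 0) : iterOp ω n θ w ≠ 0 :=
  op_ne_zero _ _ hw

lemma randomOrbit_projClass (ω : ℕ → QPCocycle d m) (θ : UnitAddTorus (Fin d))
    (w : EuclideanSpace ℝ (Fin m)) (hw : w ≠ 0) (n : ℕ) :
    randomOrbit ω ((θ, projClass w hw) : TorusProj d m) n
      = (θ + (iter ω n).freq, projClass (iterOp ω n θ w) (iterOp_ne_zero ω n θ hw)) := by
  induction n with
  | zero =>
    simp only [randomOrbit_zero, iterOp_zero]
    exact Prod.ext (by simp [iter]) rfl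
  | succ n ih =>
    rw [randomOrbit_succ, ih, smul_projClass]
    refine Prod.ext ?_ ?_
    · simp only [iter, freq_mul]; abel
    · simp only [iterOp_succ]; rfl

/-- The logarithmic growth of a vector is the sum of `psi` along its projective orbit. -/
lemma log_norm_iterOp (ω : ℕ → QPCocycle d m) (θ : UnitAddTorus (Fin d))
    (w : EuclideanSpace ℝ (Fin m)) (hw : w ≠ 0) (n : ℕ) :
    Real.log ‖iterOp ω n θ w‖ = Real.log ‖w‖ +
      orbitSum psi n ω ((θ, projClass w hw) : TorusProj d m) := by
  induction n with
  | zero => simp [iterOp_zero, orbitSum]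
  | succ n ih =>
    rw [orbitSum_succ, randomOrbit_projClass, psi_projClass, iterOp_succ,
      mul_apply_eq_comp]
    linarith

end QPCocycle

/-! ### Invariance of the skew product and convergence for maximizing measures. -/

section SkewProduct

variable {G X : Type*} [SMul G X]

/-- The skew product `(ω, x) ↦ (σ ω, ω_0 • x)` of a random walk. -/
def skewProduct (z : (ℕ → G) × X) : (ℕ → G) × X := (fun n => z.1 (n + 1), z.1 0 • z.2)

lemma birkhoffSum_skewProduct (F : G → X → ℝ) (n : ℕ) (z : (ℕ → G) × X) :
    birkhoffSum skewProduct (fun z : (ℕ → G) × X => F (z.1 0) z.2) n z = orbitSum F n z.1 z.2 := by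
  induction n generalizing z with
  | zero => simp [orbitSum]
  | succ n ih =>
    rw [birkhoffSum_succ', ih, orbitSum_succ']
    rfl

variable [MeasurableSpace G] [MeasurableSpace X] [MeasurableSMul₂ G X]
  (ν : Measure G) [IsProbabilityMeasure ν]

lemma measurable_skewProduct : Measurable (skewProduct (G := G) (X := X)) := by
  refine Measurable.prodMk (measurable_pi_lambda _ fun n => ?_) ?_
  · exact (measurable_pi_apply (n + 1)).comp measurable_fst
  · exact ((measurable_pi_apply 0).comp measurable_fst).smul measurable_snd

/-- In coordinates `(g, ω, x)` with `g` the first term, the map is `(g, ω, x) ↦ (ω, g • x)`: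
dropping `g` keeps the law of `ω`, and stationarity keeps the law of the point. -/
lemma measurePreserving_skewProduct {η : Measure X} [IsProbabilityMeasure η]
    (hη : (ν.prod η).map (fun z : G × X => z.1 • z.2) = η) :
    MeasurePreserving (skewProduct (G := G) (X := X))
      ((Measure.infinitePi fun _ : ℕ => ν).prod η) ((Measure.infinitePi fun _ : ℕ => ν).prod η) := by
  set P := Measure.infinitePi fun _ : ℕ => ν
  have hS : MeasurePreserving (Prod.map (fun p : G × (ℕ → G) => consSeq p.1 p.2) (id : X → X))
      ((ν.prod P).prod η) (P.prod η) :=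
    (measurePreserving_consSeq ν).prod (MeasurePreserving.id η)
  have hsmul : MeasurePreserving (fun z : G × X => z.1 • z.2) (ν.prod η) η :=
    ⟨measurable_fst.smul measurable_snd, hη⟩
  have hQ : MeasurePreserving (fun z : (G × (ℕ → G)) × X => (z.1.2, z.1.1 • z.2))
      ((ν.prod P).prod η) (P.prod η) :=
    ((MeasurePreserving.id P).prod hsmul).comp ((measurePreserving_prodAssoc P ν η).comp
      ((Measure.measurePreserving_swap (μ := ν) (ν := P)).prod (MeasurePreserving.id η)))
  refine ⟨measurable_skewProduct, ?_⟩
  conv_lhs => rw [← hS.map_eq]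
  rw [Measure.map_map measurable_skewProduct hS.measurable]
  exact hQ.map_eq

lemma ae_prod_of_forall_ae {Y Z : Type*} [MeasurableSpace Y] [MeasurableSpace Z] {μ : Measure Y}
    {η : Measure Z} [SFinite μ] [SFinite η] {s : Set (Y × Z)} (hs : MeasurableSet s)
    (h : ∀ z, ∀ᵐ y ∂μ, (y, z) ∈ s) : ∀ᵐ p ∂(μ.prod η), p ∈ s := by
  rw [Measure.ae_prod_mem_iff_ae_ae_mem hs]
  exact (Measure.ae_ae_comm (p := fun y z => (y, z) ∈ s) hs).2 (ae_of_all _ h)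

/-- For a stationary measure of maximal integral, averages along orbits converge almost surely. -/
lemma ae_tendsto_orbitSum_of_max {η : Measure X} [IsProbabilityMeasure η]
    (hη : (ν.prod η).map (fun z : G × X => z.1 • z.2) = η)
    {F : G → X → ℝ} (hF : Measurable (Function.uncurry F)) {C : ℝ}
    (hC : ∀ g x, |F g x| ≤ C) {c : ℝ} (hc : ∫ x, ∫ g, F g x ∂ν ∂η = c)
    (hmax : ∀ x, ∀ᵐ ω ∂(Measure.infinitePi fun _ : ℕ => ν),
      Tendsto (fun n : ℕ => max (orbitSum F n ω x / n) c) atTop (𝓝 c)) :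
    ∀ᵐ z ∂((Measure.infinitePi fun _ : ℕ => ν).prod η),
      Tendsto (fun n : ℕ => orbitSum F n z.1 z.2 / n) atTop (𝓝 c) := by
  have hfm : Measurable fun z : (ℕ → G) × X => F (z.1 0) z.2 :=
    Measurable.comp (f := fun z : (ℕ → G) × X => (z.1 0, z.2)) hF
      (((measurable_pi_apply 0).comp measurable_fst).prodMk measurable_snd)
  have hint : ∫ z, F (z.1 0) z.2 ∂((Measure.infinitePi fun _ : ℕ => ν).prod η) = c := by
    rw [integral_prod_symm _ (Integrable.of_bound hfm.aestronglyMeasurable C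
      (ae_of_all _ fun z => hC _ _)), ← hc]
    congr 1
    ext x
    have h0 := measurePreserving_eval_infinitePi (fun _ : ℕ => ν) 0
    conv_rhs => rw [← h0.map_eq]
    have hFx : Measurable fun g => F g x :=
      Measurable.comp (f := fun g => (g, x)) hF measurable_prodMk_right
    rw [integral_map h0.measurable.aemeasurable hFx.aestronglyMeasurable]
  have hav : ∀ n z, birkhoffAverage ℝ skewProduct (fun z : (ℕ → G) × X => F (z.1 0) z.2) n z
      = orbitSum F n z.1 z.2 / n := fun n z => by
    rw [birkhoffAverage, birkhoffSum_skewProduct, smul_eq_mul, inv_mul_eq_div]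
  have h := ae_tendsto_birkhoffAverage_of_max (measurePreserving_skewProduct ν hη) hfm
    (fun z => hC _ _) hint
  simp only [hav] at h
  refine h (ae_prod_of_forall_ae ?_ hmax)
  exact measurableSet_tendsto _ fun n => ((measurable_orbitSum hF n).div_const _).max measurable_const

end SkewProduct

/-! ### Haar measure as the only stationary measure on the torus. -/

section Marginal

instance (d : ℕ) : IsProbabilityMeasure (torusHaar d) := by
  unfold torusHaar; infer_instance

instance (d : ℕ) : (torusHaar d).IsOpenPosMeasure := by
  unfold torusHaar; infer_instance

instance (d : ℕ) : (torusHaar d).IsAddRightInvariant := by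
  unfold torusHaar; infer_instance

open UnitAddTorus

lemma mFourier_apply_add {ι : Type*} [Fintype ι] (k : ι → ℤ) (x y : UnitAddTorus ι) :
    mFourier k (x + y) = mFourier k x * mFourier k y := by
  simp only [mFourier, ContinuousMap.coe_mk, ← Finset.prod_mul_distrib]
  refine Finset.prod_congr rfl fun i _ => ?_
  simp [fourier_apply, AddCircle.toCircle_add, smul_add]

/-- The functions with equal integrals form a closed subspace containing the characters, whose span
is dense. -/
lemma integral_congr_of_mFourier {ι : Type*} [Fintype ι] {ρ ρ' : Measure (UnitAddTorus ι)}
    [IsProbabilityMeasure ρ] [IsProbabilityMeasure ρ']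
    (h : ∀ k, ∫ x, mFourier k x ∂ρ = ∫ x, mFourier k x ∂ρ') : ρ = ρ' := by
  have hint : ∀ (μ : Measure (UnitAddTorus ι)) [IsProbabilityMeasure μ] (f : C(UnitAddTorus ι, ℂ)),
      Integrable f μ := fun μ _ f => Integrable.of_bound
        f.continuous.measurable.aestronglyMeasurable ‖f‖ (ae_of_all _ f.norm_coe_le_norm)
  have hcont : ∀ (μ : Measure (UnitAddTorus ι)) [IsProbabilityMeasure μ],
      Continuous fun f : C(UnitAddTorus ι, ℂ) => ∫ x, f x ∂μ := fun μ _ => by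
    refine (LipschitzWith.of_dist_le_mul (K := 1) fun f g => ?_).continuous
    rw [dist_eq_norm, ← integral_sub (hint μ f) (hint μ g), NNReal.coe_one, one_mul, dist_eq_norm]
    refine (norm_integral_le_of_norm_le_const (ae_of_all _ (f - g).norm_coe_le_norm)).trans ?_
    simp
  let S : Submodule ℂ C(UnitAddTorus ι, ℂ) :=
    { carrier := {f | ∫ x, f x ∂ρ = ∫ x, f x ∂ρ'}
      add_mem' := fun {f g} hf hg => by
        change ∫ x, (f x + g x) ∂ρ = ∫ x, (f x + g x) ∂ρ'
        rw [integral_add (hint ρ f) (hint ρ g), integral_add (hint ρ' f) (hint ρ' g)]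
        exact congrArg₂ _ hf hg
      zero_mem' := by simp
      smul_mem' := fun c f hf => by
        change ∫ x, c * f x ∂ρ = ∫ x, c * f x ∂ρ'
        rw [integral_const_mul, integral_const_mul]
        exact congrArg _ hf }
  have hS : IsClosed (S : Set C(UnitAddTorus ι, ℂ)) := isClosed_eq (hcont ρ) (hcont ρ')
  have hle : Submodule.span ℂ (Set.range (mFourier (d := ι))) ≤ S :=
    Submodule.span_le.2 (by rintro _ ⟨k, rfl⟩; exact h k)
  have htop : (⊤ : Submodule ℂ C(UnitAddTorus ι, ℂ)) ≤ S :=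
    span_mFourier_closure_eq_top (d := ι) ▸ Submodule.topologicalClosure_minimal _ hle hS
  refine ext_of_forall_integral_eq_of_IsFiniteMeasure fun f => ?_
  have hf : ∫ x, ((f x : ℝ) : ℂ) ∂ρ = ∫ x, ((f x : ℝ) : ℂ) ∂ρ' :=
    htop (x := ⟨fun x => ((f x : ℝ) : ℂ), by fun_prop⟩) trivial
  rw [integral_complex_ofReal, integral_complex_ofReal] at hf
  exact_mod_cast hf

variable {d m : ℕ}

/-- For ergodic `ν` a character whose mean over the frequencies is `1` is trivial. -/
lemma QPCocycle.IsErgodic.mFourier_eq_one {ν : Measure (QPCocycle d m)} [IsProbabilityMeasure ν]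
    (hν : QPCocycle.IsErgodic ν) (k : Fin d → ℤ)
    (hk : ∫ g : QPCocycle d m, mFourier k g.freq ∂ν = 1) (θ : UnitAddTorus (Fin d)) :
    mFourier k θ = 1 := by
  have hnorm : ∀ x : UnitAddTorus (Fin d), ‖mFourier k x‖ ≤ 1 := fun x =>
    ((mFourier k).norm_coe_le_norm x).trans mFourier_norm.le
  have hcont : Continuous fun g : QPCocycle d m => mFourier k g.freq :=
    (mFourier k).continuous.comp QPCocycle.continuous_freq
  have hi : Integrable (fun g : QPCocycle d m => mFourier k g.freq) ν :=
    Integrable.of_bound hcont.measurable.aestronglyMeasurable 1 (ae_of_all _ fun g => hnorm _)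
  have hir : Integrable (fun g : QPCocycle d m => (mFourier k g.freq).re) ν := hi.re
  -- Numbers in the unit disc with mean `1` are almost surely `1`.
  have hre : ∀ᵐ g ∂ν, mFourier k (QPCocycle.freq g) = 1 := by
    have h1 : ∫ g : QPCocycle d m, (1 - (mFourier k g.freq).re) ∂ν = 0 := by
      rw [integral_sub (integrable_const _) hir]
      have : ∫ g : QPCocycle d m, (mFourier k g.freq).re ∂ν = 1 := by
        have := integral_re hi
        rw [hk] at this
        simpa using this
      simp [this]
    have h2 := (integral_eq_zero_iff_of_nonneg (fun g => sub_nonneg.2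
      ((Complex.re_le_norm _).trans (hnorm _))) ((integrable_const (1 : ℝ)).sub hir)).1 h1
    filter_upwards [h2] with g hg
    have hg1 : (mFourier k g.freq).re = 1 := (sub_eq_zero.1 hg).symm
    have h3 : ‖mFourier k g.freq‖ ^ 2 ≤ 1 := pow_le_one₀ (norm_nonneg _) (hnorm _)
    rw [Complex.sq_norm, Complex.normSq_apply, hg1] at h3
    have h4 : (mFourier k g.freq).im = 0 := by nlinarith
    exact Complex.ext (by simpa using hg1) (by simpa using h4)
  have hfm : Continuous fun z : (ℤ → QPCocycle d m) × UnitAddTorus (Fin d) => mFourier k z.2 :=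
    (mFourier k).continuous.comp continuous_snd
  -- The character of `θ` is now invariant under the base map, so ergodicity makes it almost
  -- everywhere constant; continuity and full support of Haar measure make it constant.
  obtain ⟨c, hc⟩ := Ergodic.ae_eq_const_of_ae_eq_comp_ae (g := fun z :
    (ℤ → QPCocycle d m) × UnitAddTorus (Fin d) => mFourier k z.2) hν
    ((mFourier k).continuous.measurable.comp measurable_snd).aestronglyMeasurable (by
      have h0 := (measurePreserving_eval_infinitePi (fun _ : ℤ => ν) 0).quasiMeasurePreserving.comp
        (Measure.quasiMeasurePreserving_fst (μ := Measure.infinitePi fun _ : ℤ => ν)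
          (ν := torusHaar d))
      filter_upwards [h0.ae hre] with z hz
      simp only [Function.comp, QPCocycle.baseMap, mFourier_apply_add] at hz ⊢
      rw [hz, mul_one])
  have hc' : ∀ᵐ x ∂(torusHaar d), mFourier k x = c := by
    have hsnd := (measurePreserving_snd (μ := Measure.infinitePi fun _ : ℤ => ν)
      (ν := torusHaar d))
    rw [← hsnd.map_eq, ae_map_iff hsnd.measurable.aemeasurable
      (measurableSet_eq_fun (mFourier k).continuous.measurable measurable_const)]
    exact hc
  have heq : (fun x => mFourier k x) = fun _ => c :=
    Continuous.ae_eq_iff_eq (torusHaar d) (mFourier k).continuous continuous_const |>.1 hc'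
  have h0 : mFourier k 0 = 1 := by simp [mFourier]
  rw [congrFun heq θ, ← congrFun heq 0, h0]

/-- For ergodic `ν` the Haar measure is the only stationary measure on the torus. -/
lemma QPCocycle.IsErgodic.eq_torusHaar {ν : Measure (QPCocycle d m)} [IsProbabilityMeasure ν]
    (hν : QPCocycle.IsErgodic ν) {ρ : Measure (UnitAddTorus (Fin d))} [IsProbabilityMeasure ρ]
    (hρ : (ν.prod ρ).map (fun z => z.2 + z.1.freq) = ρ) : ρ = torusHaar d := by
  refine integral_congr_of_mFourier fun k => ?_
  have hm : Measurable fun z : QPCocycle d m × UnitAddTorus (Fin d) => z.2 + z.1.freq :=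
    measurable_snd.add (QPCocycle.continuous_freq.measurable.comp measurable_fst)
  by_cases hk : ∫ g : QPCocycle d m, mFourier k g.freq ∂ν = 1
  · simp [hν.mFourier_eq_one k hk]
  -- Stationarity multiplies the Fourier coefficient by the mean of the character over the
  -- frequencies. When this mean is not `1`, the coefficient vanishes for `ρ` and for Haar measure
  -- alike.
  have hzero : ∀ I : ℂ, (∫ g : QPCocycle d m, mFourier k g.freq ∂ν) * I = I → I = 0 := fun I hI => by
    have : ((∫ g : QPCocycle d m, mFourier k g.freq ∂ν) - 1) * I = 0 := by rw [sub_mul, hI]; ring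
    exact (mul_eq_zero.1 this).resolve_left (sub_ne_zero.2 hk)
  rw [hzero (∫ x, mFourier k x ∂ρ), hzero (∫ x, mFourier k x ∂(torusHaar d))]
  · have h1 : ∀ g : QPCocycle d m, mFourier k g.freq * ∫ x, mFourier k x ∂(torusHaar d) =
        ∫ x, mFourier k x ∂(torusHaar d) := fun g => by
      rw [← integral_const_mul]
      conv_rhs => rw [← integral_add_right_eq_self _ g.freq]
      simp only [mFourier_apply_add, mul_comm]
    rw [← integral_mul_const]
    simp [h1]
  · conv_rhs => rw [← hρ]
    rw [integral_map hm.aemeasurable (mFourier k).continuous.measurable.aestronglyMeasurable]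
    simp only [mFourier_apply_add]
    simp_rw [mul_comm (mFourier k (_ : QPCocycle d m × UnitAddTorus (Fin d)).2)]
    exact (integral_prod_mul (fun g : QPCocycle d m => mFourier k g.freq) (fun x => mFourier k x)).symm

end Marginal

/-! ### Upper limits of real and extended real sequences. -/

section Sequences

lemma tendsto_max_of_add {u ε : ℕ → ℝ} {c : ℝ} (hε : Tendsto ε atTop (𝓝 0))
    (hu : Tendsto (fun n => max (u n) c) atTop (𝓝 c)) :
    Tendsto (fun n => max (ε n + u n) c) atTop (𝓝 c) := by
  rw [tendsto_max_iff_forall_gt] at hu ⊢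
  intro b hb
  obtain ⟨b', hb', hb'b⟩ := exists_between hb
  filter_upwards [hu b' hb', hε.eventually_lt_const (sub_pos.2 hb'b)] with n h1 h2
  linarith

lemma tendsto_of_tendsto_max {u : ℕ → ℝ} {c : ℝ}
    (h1 : Tendsto (fun n => max (u n) c) atTop (𝓝 c))
    (h2 : Tendsto (fun n => max (-u n) (-c)) atTop (𝓝 (-c))) : Tendsto u atTop (𝓝 c) := by
  rw [tendsto_max_iff_forall_gt] at h1 h2
  refine tendsto_order.2 ⟨fun a ha => ?_, h1⟩
  filter_upwards [h2 (-a) (neg_lt_neg ha)] with n hn using neg_lt_neg_iff.1 hn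

lemma limsup_log_enorm_div_le {E : Type*} [NormedAddCommGroup E] {u : ℕ → E} (hu : ∀ n, u n ≠ 0) {c : ℝ}
    (h : Tendsto (fun n : ℕ => max ((1 / (n : ℝ)) * Real.log ‖u n‖) c) atTop (𝓝 c)) :
    limsup (fun n : ℕ => ENNReal.log ‖u n‖ₑ / ((n : ℝ) : EReal)) atTop ≤ (c : EReal) := by
  have h1 : ∀ᶠ n : ℕ in atTop, ENNReal.log ‖u n‖ₑ / ((n : ℝ) : EReal) ≤
      ((max ((1 / (n : ℝ)) * Real.log ‖u n‖) c : ℝ) : EReal) := by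
    refine Eventually.of_forall fun n => ?_
    rw [← ofReal_norm, ENNReal.log_ofReal_of_pos (norm_pos_iff.2 (hu n)), ← EReal.coe_div,
      EReal.coe_le_coe_iff, one_div, inv_mul_eq_div]
    exact le_max_left _ _
  refine (limsup_le_limsup h1).trans (le_of_eq ?_)
  exact ((continuous_coe_real_ereal.tendsto c).comp h).limsup_eq

end Sequences

/-! ### Growth of vectors and of operator norms. -/

namespace QPCocycle

variable {d m : ℕ}

/-- On a compact set of cocycles `psi` agrees with a bounded function. -/
lemma exists_bounded_psi {ν : Measure (QPCocycle d m)} (hcompact : IsCompact ν.support) :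
    ∃ (F : QPCocycle d m → TorusProj d m → ℝ) (C : ℝ), Measurable (Function.uncurry F) ∧
      (∀ g x, |F g x| ≤ C) ∧ (∀ g, Continuous (F g)) ∧ ∀ᵐ g ∂ν, F g = psi g := by
  obtain ⟨C, hC⟩ := (hcompact.prod (isCompact_univ (X := TorusProj d m))).exists_bound_of_continuousOn
    continuous_psi.continuousOn
  -- Cutting `psi` off outside the support gives a bound valid everywhere, as the random walk lemmas
  -- require; `max C 0` covers the points where the function is `0`.
  refine ⟨fun g x => (ν.support ×ˢ Set.univ).indicator
    (fun z : QPCocycle d m × TorusProj d m => psi z.1 z.2) (g, x), max C 0, ?_, fun g x => ?_,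
    fun g => ?_, ?_⟩
  · exact continuous_psi.measurable.indicator
      (Measure.isClosed_support.measurableSet.prod MeasurableSet.univ)
  · by_cases hg : g ∈ ν.support
    · have hmem : (g, x) ∈ ν.support ×ˢ (Set.univ : Set (TorusProj d m)) := ⟨hg, Set.mem_univ x⟩
      simp only [Set.indicator_of_mem hmem]
      exact (hC _ hmem).trans (le_max_left _ _)
    · have hmem : (g, x) ∉ ν.support ×ˢ (Set.univ : Set (TorusProj d m)) := fun h => hg h.1
      simp only [Set.indicator_of_notMem hmem, abs_zero]
      exact le_max_right _ _
  · by_cases hg : g ∈ ν.support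
    · have : ∀ x, (g, x) ∈ ν.support ×ˢ (Set.univ : Set (TorusProj d m)) :=
        fun x => ⟨hg, Set.mem_univ x⟩
      simp only [Set.indicator_of_mem (this _)]
      have hc : Continuous fun x : TorusProj d m => (g, x) := continuous_const.prodMk continuous_id
      simpa only [Function.comp_def] using continuous_psi.comp hc
    · have : ∀ x, (g, x) ∉ ν.support ×ˢ (Set.univ : Set (TorusProj d m)) := fun x h => hg h.1
      simp only [Set.indicator_of_notMem (this _)]
      exact continuous_const
  · filter_upwards [Measure.support_mem_ae (μ := ν)] with g hg
    ext x
    exact Set.indicator_of_mem (show (g, x) ∈ ν.support ×ˢ (Set.univ : Set (TorusProj d m)) from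
      ⟨hg, Set.mem_univ x⟩) _

lemma ae_orbitSum_eq {ν : Measure (QPCocycle d m)} [IsProbabilityMeasure ν]
    {F : QPCocycle d m → TorusProj d m → ℝ} (hF : ∀ᵐ g ∂ν, F g = psi g) :
    ∀ᵐ ω ∂(Measure.infinitePi fun _ : ℕ => ν), ∀ n x, orbitSum F n ω x = orbitSum psi n ω x := by
  have h : ∀ᵐ ω ∂(Measure.infinitePi fun _ : ℕ => ν), ∀ k, F (ω k) = psi (ω k) :=
    ae_all_iff.2 fun k =>
      (measurePreserving_eval_infinitePi (fun _ : ℕ => ν) k).quasiMeasurePreserving.ae hF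
  filter_upwards [h] with ω hω n x
  exact Finset.sum_congr rfl fun j _ => by rw [hω]

lemma log_norm_iterOp_div (ω : ℕ → QPCocycle d m) (θ : UnitAddTorus (Fin d))
    (w : EuclideanSpace ℝ (Fin m)) (hw : w ≠ 0) (n : ℕ) :
    (1 / (n : ℝ)) * Real.log ‖iterOp ω n θ w‖ =
      Real.log ‖w‖ / n + orbitSum psi n ω ((θ, projClass w hw) : TorusProj d m) / n := by
  rw [log_norm_iterOp ω θ w hw]
  ring

lemma norm_iterOp_pos (hm : 1 ≤ m) (ω : ℕ → QPCocycle d m) (n : ℕ) (θ : UnitAddTorus (Fin d)) :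
    0 < ‖iterOp ω n θ‖ := by
  refine norm_pos_iff.2 fun h => ?_
  have hw : EuclideanSpace.single (⟨0, hm⟩ : Fin m) (1 : ℝ) ≠ 0 := by simp
  exact iterOp_ne_zero ω n θ hw (by rw [h]; rfl)

/-- The orbit sum from any point is a lower bound for the growth of the operator norm. -/
lemma orbitSum_le_log_norm_iterOp (ω : ℕ → QPCocycle d m) (n : ℕ) (x : TorusProj d m) :
    orbitSum psi n ω x ≤ Real.log ‖iterOp ω n x.1‖ := by
  obtain ⟨s, hs⟩ := surjective_sphereProj x.2
  have hs1 : ‖s.1‖ = 1 := by simp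
  have h := log_norm_iterOp ω x.1 s.1 (ne_zero_of_mem_unit_sphere s) n
  have hx : ((x.1, projClass s.1 (ne_zero_of_mem_unit_sphere s)) : TorusProj d m) = x :=
    Prod.ext rfl hs
  rw [hs1, Real.log_one, zero_add, hx] at h
  rw [← h]
  refine Real.log_le_log (norm_pos_iff.2 (iterOp_ne_zero _ _ _ (ne_zero_of_mem_unit_sphere s))) ?_
  exact (iterOp ω n x.1).unit_le_opNorm _ hs1.le

lemma abs_log_norm_iterOp_le (hm : 1 ≤ m) {ω : ℕ → QPCocycle d m} {n : ℕ} {θ : UnitAddTorus (Fin d)}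
    {D : ℝ} (hD : ∀ p, |orbitSum psi n ω ((θ, p) : TorusProj d m)| ≤ D) :
    |Real.log ‖iterOp ω n θ‖| ≤ D := by
  obtain ⟨p⟩ := nonempty_projSpace hm
  refine abs_le.2 ⟨(abs_le.1 (hD p)).1.trans (orbitSum_le_log_norm_iterOp ω n (θ, p)), ?_⟩
  rw [Real.log_le_iff_le_exp (norm_iterOp_pos hm ω n θ)]
  refine ContinuousLinearMap.opNorm_le_bound _ (Real.exp_pos _).le fun w => ?_
  rcases eq_or_ne w 0 with rfl | hw
  · simp
  have hpos := norm_pos_iff.2 (iterOp_ne_zero ω n θ hw)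
  rw [← Real.log_le_log_iff hpos (mul_pos (Real.exp_pos _) (norm_pos_iff.2 hw)),
    Real.log_mul (Real.exp_pos _).ne' (norm_ne_zero_iff.2 hw), Real.log_exp,
    log_norm_iterOp ω θ w hw]
  linarith [(abs_le.1 (hD (projClass w hw))).2]

/-- Reduces the operator norm to finitely many vectors, each with its own null set of exceptional
sequences. -/
lemma norm_le_sum_norm_single (A : EuclideanSpace ℝ (Fin m) →L[ℝ] EuclideanSpace ℝ (Fin m)) :
    ‖A‖ ≤ ∑ i, ‖A (EuclideanSpace.single i 1)‖ := by
  refine A.opNorm_le_bound (Finset.sum_nonneg fun i _ => norm_nonneg _) fun w => ?_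
  have hw : w = ∑ i, w i • EuclideanSpace.single i (1 : ℝ) := by
    ext j
    simp [Pi.single_apply]
  conv_lhs => rw [hw]
  rw [map_sum, Finset.sum_mul]
  refine (norm_sum_le _ _).trans (Finset.sum_le_sum fun i _ => ?_)
  rw [map_smul, norm_smul, mul_comm]
  gcongr
  exact PiLp.norm_apply_le w i

/-- The upper growth rate of the operator norm is controlled by that of the basis vectors. -/
lemma tendsto_max_log_norm_iterOp (hm : 1 ≤ m) {ω : ℕ → QPCocycle d m} {θ : UnitAddTorus (Fin d)} {c : ℝ}
    (h : ∀ i : Fin m, Tendsto (fun n : ℕ => max ((1 / (n : ℝ)) *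
      Real.log ‖iterOp ω n θ (EuclideanSpace.single i 1)‖) c) atTop (𝓝 c)) :
    Tendsto (fun n : ℕ => max ((1 / (n : ℝ)) * Real.log ‖iterOp ω n θ‖) c) atTop (𝓝 c) := by
  simp only [tendsto_max_iff_forall_gt] at h ⊢
  intro b hb
  obtain ⟨b', hb', hb'b⟩ := exists_between hb
  have hm' : (0 : ℝ) < m := by exact_mod_cast hm
  -- Summing over the `m` basis vectors costs only `log m / n`.
  have h1 : Tendsto (fun n : ℕ => Real.log m / (n : ℝ)) atTop (𝓝 0) :=
    tendsto_natCast_atTop_atTop.const_div_atTop _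
  filter_upwards [eventually_all.2 fun i => h i b' hb', h1.eventually_lt_const (sub_pos.2 hb'b),
    eventually_ge_atTop 1] with n hn hn1 hn0
  have hn' : (0 : ℝ) < n := by exact_mod_cast hn0
  have h2 : ‖iterOp ω n θ‖ ≤ m * Real.exp (n * b') := by
    refine (norm_le_sum_norm_single _).trans ?_
    refine (Finset.sum_le_card_nsmul _ _ (Real.exp (n * b')) fun i _ => ?_).trans (by simp)
    have hi := hn i
    rw [one_div, inv_mul_lt_iff₀ hn'] at hi
    exact (Real.lt_exp_of_log_lt hi).le
  have h3 := Real.log_le_log (norm_iterOp_pos hm ω n θ) h2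
  rw [Real.log_mul hm'.ne' (Real.exp_pos _).ne', Real.log_exp] at h3
  rw [div_lt_iff₀ hn'] at hn1
  rw [one_div, inv_mul_lt_iff₀ hn']
  linarith

lemma measurable_log_norm_iterOp (n : ℕ) :
    Measurable fun z : (ℕ → QPCocycle d m) × UnitAddTorus (Fin d) =>
      (1 / (n : ℝ)) * Real.log ‖iterOp z.1 n z.2‖ :=
  (Real.measurable_log.comp (continuous_iterOp n).norm.measurable).const_mul _

lemma measurable_restrict_nat : Measurable fun (ω : ℤ → QPCocycle d m) (k : ℕ) => ω (k : ℤ) :=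
  measurable_pi_lambda _ fun _ => measurable_pi_apply _

lemma measurable_logAverage (n : ℕ) : Measurable (logAverage (d := d) (m := m) n) := by
  have h : Measurable fun z : (ℤ → QPCocycle d m) × UnitAddTorus (Fin d) =>
      ((fun k : ℕ => z.1 (k : ℤ)), z.2) :=
    (measurable_restrict_nat.comp measurable_fst).prodMk measurable_snd
  have e : logAverage n = (fun z : (ℕ → QPCocycle d m) × UnitAddTorus (Fin d) =>
      (1 / (n : ℝ)) * Real.log ‖iterOp z.1 n z.2‖) ∘
      fun z : (ℤ → QPCocycle d m) × UnitAddTorus (Fin d) => ((fun k : ℕ => z.1 (k : ℤ)), z.2) := rfl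
  rw [e]
  exact (measurable_log_norm_iterOp n).comp h

lemma measurePreserving_restrict_nat (ν : Measure (QPCocycle d m)) [IsProbabilityMeasure ν] :
    MeasurePreserving (fun (ω : ℤ → QPCocycle d m) (k : ℕ) => ω (k : ℤ))
      (Measure.infinitePi fun _ : ℤ => ν) (Measure.infinitePi fun _ : ℕ => ν) := by
  refine ⟨measurable_restrict_nat, Measure.eq_infinitePi _ fun s t ht => ?_⟩
  have hpre : (fun (ω : ℤ → QPCocycle d m) (k : ℕ) => ω (k : ℤ)) ⁻¹' (s : Set ℕ).pi t =
      ((s.map Nat.castEmbedding : Finset ℤ) : Set ℤ).pi fun i => t i.toNat := by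
    ext ω
    simp [Set.mem_pi]
  rw [Measure.map_apply measurable_restrict_nat (MeasurableSet.pi (Finset.countable_toSet _) fun i _ => ht i), hpre,
    Measure.infinitePi_pi _ fun i _ => ht _, Finset.prod_map]
  simp

lemma measurePreserving_restrict_nat_prod (ν : Measure (QPCocycle d m)) [IsProbabilityMeasure ν] :
    MeasurePreserving (fun z : (ℤ → QPCocycle d m) × UnitAddTorus (Fin d) =>
      ((fun k : ℕ => z.1 (k : ℤ)), z.2)) (twoSidedMeasure ν)
      ((Measure.infinitePi fun _ : ℕ => ν).prod (torusHaar d)) :=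
  (measurePreserving_restrict_nat ν).prod (MeasurePreserving.id _)

/-- The projection to the torus intertwines the action with translation by the frequency, so the
marginal is stationary for the random translations. -/
lemma IsErgodic.map_fst_eq {ν : Measure (QPCocycle d m)} [IsProbabilityMeasure ν]
    (hν : IsErgodic ν) {η : Measure (TorusProj d m)} (hη : IsStationaryMeasure ν η) :
    η.map Prod.fst = torusHaar d := by
  have := hη.1
  have : IsProbabilityMeasure (η.map Prod.fst) :=
    Measure.isProbabilityMeasure_map measurable_fst.aemeasurable
  refine hν.eq_torusHaar ?_
  have hm : Measurable fun z : QPCocycle d m × UnitAddTorus (Fin d) => z.2 + z.1.freq :=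
    measurable_snd.add (continuous_freq.measurable.comp measurable_fst)
  have hprod : ν.prod (η.map Prod.fst) = (ν.prod η).map (Prod.map id Prod.fst) :=
    (((MeasurePreserving.id ν).prod
      (⟨measurable_fst, rfl⟩ : MeasurePreserving Prod.fst η (η.map Prod.fst))).map_eq).symm
  rw [hprod, Measure.map_map hm (measurable_id.prodMap measurable_fst)]
  conv_rhs => rw [← hη.2]
  rw [Measure.map_map (g := Prod.fst) (f := fun z : QPCocycle d m × TorusProj d m => z.1 • z.2)
    measurable_fst (measurable_fst.smul measurable_snd)]
  rfl

/-- Upper bound for the growth of vectors. -/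
lemma ae_tendsto_max_log_norm_apply {ν : Measure (QPCocycle d m)} {c : ℝ}
    (hup : ∀ x : TorusProj d m, ∀ᵐ ω ∂(Measure.infinitePi fun _ : ℕ => ν),
      Tendsto (fun n : ℕ => max (orbitSum psi n ω x / n) c) atTop (𝓝 c))
    (θ : UnitAddTorus (Fin d)) {w : EuclideanSpace ℝ (Fin m)} (hw : w ≠ 0) :
    ∀ᵐ ω ∂(Measure.infinitePi fun _ : ℕ => ν),
      Tendsto (fun n : ℕ => max ((1 / (n : ℝ)) * Real.log ‖iterOp ω n θ w‖) c) atTop (𝓝 c) := by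
  filter_upwards [hup (θ, projClass w hw)] with ω hω
  simp only [log_norm_iterOp_div ω θ w hw]
  exact tendsto_max_of_add (tendsto_natCast_atTop_atTop.const_div_atTop _) hω

/-- Upper bound for the growth of the operator norm. -/
lemma ae_tendsto_max_log_norm (hm : 1 ≤ m) {ν : Measure (QPCocycle d m)} [IsProbabilityMeasure ν]
    {c : ℝ}
    (hup : ∀ x : TorusProj d m, ∀ᵐ ω ∂(Measure.infinitePi fun _ : ℕ => ν),
      Tendsto (fun n : ℕ => max (orbitSum psi n ω x / n) c) atTop (𝓝 c)) :
    ∀ᵐ z ∂((Measure.infinitePi fun _ : ℕ => ν).prod (torusHaar d)),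
      Tendsto (fun n : ℕ => max ((1 / (n : ℝ)) * Real.log ‖iterOp z.1 n z.2‖) c) atTop (𝓝 c) := by
  refine ae_prod_of_forall_ae (measurableSet_tendsto _ fun n =>
    (measurable_log_norm_iterOp n).max measurable_const) fun θ => ?_
  have h : ∀ i : Fin m, (EuclideanSpace.single i (1 : ℝ)) ≠ 0 := fun i => by simp
  filter_upwards [ae_all_iff.2 fun i => ae_tendsto_max_log_norm_apply hup θ (h i)] with ω hω
  exact tendsto_max_log_norm_iterOp hm hω

/-- Lower bound for the growth of the operator norm. -/
lemma IsErgodic.ae_tendsto_max_neg_log_norm {ν : Measure (QPCocycle d m)}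
    [IsProbabilityMeasure ν] (hν : IsErgodic ν) {η : Measure (TorusProj d m)}
    (hη : IsStationaryMeasure ν η) {c : ℝ}
    (hlim : ∀ᵐ z ∂((Measure.infinitePi fun _ : ℕ => ν).prod η),
      Tendsto (fun n : ℕ => orbitSum psi n z.1 z.2 / n) atTop (𝓝 c)) :
    ∀ᵐ z ∂((Measure.infinitePi fun _ : ℕ => ν).prod (torusHaar d)),
      Tendsto (fun n : ℕ => max (-((1 / (n : ℝ)) * Real.log ‖iterOp z.1 n z.2‖)) (-c)) atTop
        (𝓝 (-c)) := by
  have := hη.1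
  -- Haar measure being the marginal of `η`, a property of `θ` may be tested at `η`-almost every
  -- `(θ, p)`, where `p` supplies a direction of growth `c`.
  have hmp : MeasurePreserving
      (Prod.map id Prod.fst : (ℕ → QPCocycle d m) × TorusProj d m → _)
      ((Measure.infinitePi fun _ : ℕ => ν).prod η)
      ((Measure.infinitePi fun _ : ℕ => ν).prod (torusHaar d)) :=
    (MeasurePreserving.id _).prod ⟨measurable_fst, hν.map_fst_eq hη⟩
  rw [← hmp.map_eq]
  have hneg : ∀ n : ℕ, Measurable fun z : (ℕ → QPCocycle d m) × UnitAddTorus (Fin d) =>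
      -((1 / (n : ℝ)) * Real.log ‖iterOp z.1 n z.2‖) := fun n => (measurable_log_norm_iterOp n).neg
  refine (ae_map_iff hmp.measurable.aemeasurable (measurableSet_tendsto _ fun n =>
    (hneg n).max measurable_const)).2 ?_
  filter_upwards [hlim] with z hz
  rw [tendsto_max_iff_forall_gt]
  intro b hb
  filter_upwards [hz.eventually_const_lt (neg_lt.1 hb)] with n hn
  change -((1 / (n : ℝ)) * Real.log ‖iterOp z.1 n z.2.1‖) < b
  rw [neg_lt]
  refine hn.trans_le ?_
  rw [one_div, inv_mul_eq_div]
  exact div_le_div_of_nonneg_right (orbitSum_le_log_norm_iterOp z.1 n z.2) (Nat.cast_nonneg n)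

/-- On the support of `ν` the cocycle `psi` agrees with a bounded function with continuous mean. -/
lemma exists_potential {ν : Measure (QPCocycle d m)} [IsProbabilityMeasure ν]
    (hcompact : IsCompact ν.support) :
    ∃ (F : QPCocycle d m → TorusProj d m → ℝ) (C : ℝ) (φ : C(TorusProj d m, ℝ)),
      Measurable (Function.uncurry F) ∧ (∀ g x, |F g x| ≤ C) ∧ (∀ᵐ g ∂ν, F g = psi g) ∧
      ∀ x, φ x = ∫ g, F g x ∂ν := by
  obtain ⟨F, C, hFm, hFC, hFc, hFpsi⟩ := exists_bounded_psi hcompact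
  have hFx : ∀ x, Measurable fun g => F g x := fun x =>
    Measurable.comp (f := fun g => (g, x)) hFm measurable_prodMk_right
  exact ⟨F, C, ⟨fun x => ∫ g, F g x ∂ν, continuous_of_dominated
    (bound := fun _ => C) (fun x => (hFx x).aestronglyMeasurable)
    (fun x => ae_of_all _ fun g => hFC g x) (integrable_const _) (ae_of_all _ hFc)⟩,
    hFm, hFC, hFpsi, fun _ => rfl⟩

section Potential

variable {ν : Measure (QPCocycle d m)} [IsProbabilityMeasure ν]
  {F : QPCocycle d m → TorusProj d m → ℝ} {C : ℝ} (hFm : Measurable (Function.uncurry F))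
  (hFC : ∀ g x, |F g x| ≤ C) (hFpsi : ∀ᵐ g ∂ν, F g = psi g)

include hFm hFC in
lemma integrable_potential (η : Measure (TorusProj d m)) [IsProbabilityMeasure η] :
    Integrable (Function.uncurry F) (ν.prod η) :=
  Integrable.of_bound hFm.aestronglyMeasurable C (ae_of_all _ fun z => hFC z.1 z.2)

include hFm hFC hFpsi

lemma integrable_psi (η : Measure (TorusProj d m)) [IsProbabilityMeasure η] :
    Integrable (fun z : QPCocycle d m × TorusProj d m => psi z.1 z.2) (ν.prod η) := by
  refine (integrable_potential hFm hFC η).congr ?_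
  filter_upwards [Measure.quasiMeasurePreserving_fst.ae hFpsi] with z hz
  exact congrFun hz z.2

lemma alpha_eq_integral (η : Measure (TorusProj d m)) [IsProbabilityMeasure η] :
    alpha ν η = ∫ x, ∫ g, F g x ∂ν ∂η := by
  have h1 : alpha ν η = ∫ g, ∫ x, F g x ∂η ∂ν :=
    integral_congr_ae (by filter_upwards [hFpsi] with g hg; rw [hg])
  rw [h1, integral_integral_swap (integrable_potential hFm hFC η)]

/-- The growth rate of the operator norm is attained by a maximizing stationary measure. -/
lemma IsErgodic.ae_tendsto_log_norm (hm : 1 ≤ m) (hν : IsErgodic ν) {η : Measure (TorusProj d m)}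
    (hη : IsStationaryMeasure ν η)
    (hupF : ∀ x : TorusProj d m, ∀ᵐ ω ∂(Measure.infinitePi fun _ : ℕ => ν),
      Tendsto (fun n : ℕ => max (orbitSum F n ω x / n) (alpha ν η)) atTop (𝓝 (alpha ν η))) :
    ∀ᵐ z ∂((Measure.infinitePi fun _ : ℕ => ν).prod (torusHaar d)),
      Tendsto (fun n : ℕ => (1 / (n : ℝ)) * Real.log ‖iterOp z.1 n z.2‖) atTop
        (𝓝 (alpha ν η)) := by
  have hp := hη.1
  have hup : ∀ x : TorusProj d m, ∀ᵐ ω ∂(Measure.infinitePi fun _ : ℕ => ν),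
      Tendsto (fun n : ℕ => max (orbitSum psi n ω x / n) (alpha ν η)) atTop (𝓝 (alpha ν η)) :=
    fun x => by
      filter_upwards [hupF x, ae_orbitSum_eq hFpsi] with ω hω he
      simpa only [he] using hω
  have hlim : ∀ᵐ z ∂((Measure.infinitePi fun _ : ℕ => ν).prod η),
      Tendsto (fun n : ℕ => orbitSum psi n z.1 z.2 / n) atTop (𝓝 (alpha ν η)) := by
    filter_upwards [ae_tendsto_orbitSum_of_max ν hη.2 hFm hFC
      (alpha_eq_integral hFm hFC hFpsi η).symm hupF,
      Measure.quasiMeasurePreserving_fst.ae (ae_orbitSum_eq hFpsi)] with z hz he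
    simpa only [he] using hz
  filter_upwards [ae_tendsto_max_log_norm hm hup, hν.ae_tendsto_max_neg_log_norm hη hlim]
    with z h1 h2 using tendsto_of_tendsto_max h1 h2

-- This uniform bound is the dominating constant for passing from almost sure convergence to
-- convergence of means.
omit hFm in
lemma ae_norm_logAverage_le (hm : 1 ≤ m) :
    ∀ᵐ z ∂(twoSidedMeasure ν), ∀ n, ‖logAverage n z‖ ≤ C := by
  have h := (Measure.quasiMeasurePreserving_fst.comp
    (measurePreserving_restrict_nat_prod ν).quasiMeasurePreserving).ae (ae_orbitSum_eq hFpsi)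
  filter_upwards [h] with z hz n
  have : Nonempty (ProjSpace m) := nonempty_projSpace hm
  have hC0 : 0 ≤ C := (abs_nonneg _).trans (hFC 1 (0, Classical.arbitrary _))
  have h1 := abs_log_norm_iterOp_le hm (ω := fun k : ℕ => z.1 (k : ℤ)) (n := n)
    (θ := z.2) (D := n * C) fun p => by
      have e : orbitSum F n (fun k : ℕ => z.1 (k : ℤ)) ((z.2, p) : TorusProj d m) =
        orbitSum psi n (fun k : ℕ => z.1 (k : ℤ)) ((z.2, p) : TorusProj d m) := hz n (z.2, p)
      rw [← e]
      exact abs_orbitSum_le hFC n _ _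
  rw [logAverage, Real.norm_eq_abs, abs_mul, abs_of_nonneg (by positivity), one_div]
  rcases Nat.eq_zero_or_pos n with rfl | hn
  · simpa using hC0
  · rwa [inv_mul_le_iff₀ (by exact_mod_cast hn)]

omit hFm in
/-- The growth rate along two-sided sequences, almost surely and in mean. -/
lemma twoSided_growth (hm : 1 ≤ m) {c : ℝ}
    (hone : ∀ᵐ z ∂((Measure.infinitePi fun _ : ℕ => ν).prod (torusHaar d)),
      Tendsto (fun n : ℕ => (1 / (n : ℝ)) * Real.log ‖iterOp z.1 n z.2‖) atTop (𝓝 c)) :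
    (∀ᵐ z ∂(twoSidedMeasure ν), Tendsto (fun n : ℕ => logAverage n z) atTop (𝓝 c)) ∧
      (∀ n : ℕ, Integrable (logAverage n) (twoSidedMeasure ν)) ∧
      Tendsto (fun n : ℕ => ∫ z, logAverage n z ∂(twoSidedMeasure ν)) atTop (𝓝 c) := by
  have hprob : IsProbabilityMeasure (twoSidedMeasure ν) := by
    unfold twoSidedMeasure; infer_instance
  have htwo : ∀ᵐ z ∂(twoSidedMeasure ν), Tendsto (fun n : ℕ => logAverage n z) atTop (𝓝 c) :=
    (measurePreserving_restrict_nat_prod ν).quasiMeasurePreserving.ae hone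
  have hbound := ae_norm_logAverage_le hFC hFpsi hm
  refine ⟨htwo, fun n => Integrable.of_bound (measurable_logAverage n).aestronglyMeasurable C
    (hbound.mono fun z hz => hz n), ?_⟩
  have := tendsto_integral_of_dominated_convergence (fun _ => C)
    (fun n => (measurable_logAverage n).aestronglyMeasurable) (integrable_const _)
    (fun n => hbound.mono fun z hz => hz n) htwo
  simpa using this

end Potential

end QPCocycle

/-! ### Assembly of the theorem. -/

theorem mainTheorem7 (d m : ℕ) (hm : 1 ≤ m) (ν : Measure (QPCocycle d m))
    [IsProbabilityMeasure ν] (hcompact : IsCompact ν.support)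
    (hergodic : QPCocycle.IsErgodic ν) :
    -- `α_ν` is well defined and attains the maximum `β(ν)`
    ((∀ η ∈ QPCocycle.stationaryMeasures ν,
        Integrable (fun z : QPCocycle d m × TorusProj d m => QPCocycle.psi z.1 z.2) (ν.prod η)) ∧
      IsGreatest (QPCocycle.alpha ν '' QPCocycle.stationaryMeasures ν) (QPCocycle.beta ν)) ∧
    -- (1)
    (∀ᵐ z ∂((Measure.infinitePi fun _ : ℕ => ν).prod (torusHaar d)),
        Tendsto (fun n : ℕ => (1 / (n : ℝ)) * Real.log ‖QPCocycle.iterOp z.1 n z.2‖) atTop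
          (𝓝 (QPCocycle.beta ν))) ∧
    -- `L_1(ν)` exists, as an almost sure limit and as a limit of means, and equals `β(ν)`
    ((∀ᵐ z ∂(QPCocycle.twoSidedMeasure ν),
        Tendsto (fun n : ℕ => QPCocycle.logAverage n z) atTop
          (𝓝 (QPCocycle.lyapunovExponent ν))) ∧
      (∀ n : ℕ, Integrable (QPCocycle.logAverage n) (QPCocycle.twoSidedMeasure ν)) ∧
      Tendsto (fun n : ℕ => ∫ z, QPCocycle.logAverage n z ∂(QPCocycle.twoSidedMeasure ν)) atTop
        (𝓝 (QPCocycle.lyapunovExponent ν)) ∧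
      QPCocycle.lyapunovExponent ν = QPCocycle.beta ν) ∧
    -- (2), with `log 0 = -∞`
    (∀ (θ : UnitAddTorus (Fin d)) (v : EuclideanSpace ℝ (Fin m)),
      ∀ᵐ ω ∂(Measure.infinitePi fun _ : ℕ => ν),
        limsup (fun n : ℕ => ENNReal.log ‖QPCocycle.iterOp ω n θ v‖ₑ / ((n : ℝ) : EReal)) atTop
          ≤ ((QPCocycle.beta ν : ℝ) : EReal)) ∧
    -- (3)
    ((∃ c : ℝ, ∀ η ∈ QPCocycle.stationaryMeasures ν, QPCocycle.alpha ν η = c) →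
      ∀ (θ : UnitAddTorus (Fin d)) (v : EuclideanSpace ℝ (Fin m)), v ≠ 0 →
        ∀ᵐ ω ∂(Measure.infinitePi fun _ : ℕ => ν),
          Tendsto (fun n : ℕ => (1 / (n : ℝ)) * Real.log ‖QPCocycle.iterOp ω n θ v‖) atTop
            (𝓝 (QPCocycle.beta ν))) := by
  have : Nonempty (ProjSpace m) := nonempty_projSpace hm
  obtain ⟨F, C, φ, hFm, hFC, hFpsi, hφ⟩ := QPCocycle.exists_potential hcompact
  have halpha : ∀ η ∈ QPCocycle.stationaryMeasures ν, QPCocycle.alpha ν η = ∫ x, φ x ∂η := by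
    rintro η ⟨hp, -⟩
    rw [QPCocycle.alpha_eq_integral hFm hFC hFpsi]
    simp only [hφ]
  have himage : QPCocycle.alpha ν '' QPCocycle.stationaryMeasures ν =
      {a | ∃ η, IsStationaryMeasure ν η ∧ ∫ x, φ x ∂η = a} := by
    ext a
    constructor
    · rintro ⟨η, hη, rfl⟩
      exact ⟨η, hη, (halpha η hη).symm⟩
    · rintro ⟨η, hη, rfl⟩
      exact ⟨η, hη, halpha η hη⟩
  obtain ⟨c, hc, hcavg⟩ := exists_isGreatest_integral ν φ
  rw [← himage] at hc
  have hbeta : QPCocycle.beta ν = c := hc.csSup_eq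
  have hupF := ae_tendsto_max_orbitSum ν hFm hFC φ hφ hcavg
  have hup : ∀ x : TorusProj d m, ∀ᵐ ω ∂(Measure.infinitePi fun _ : ℕ => ν),
      Tendsto (fun n : ℕ => max (orbitSum QPCocycle.psi n ω x / n) c) atTop (𝓝 c) := fun x => by
    filter_upwards [hupF x, QPCocycle.ae_orbitSum_eq hFpsi] with ω hω he
    simpa only [he] using hω
  have hone : ∀ᵐ z ∂((Measure.infinitePi fun _ : ℕ => ν).prod (torusHaar d)),
      Tendsto (fun n : ℕ => (1 / (n : ℝ)) * Real.log ‖QPCocycle.iterOp z.1 n z.2‖) atTop (𝓝 c) := by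
    obtain ⟨η, hη, hηc⟩ := hc.1
    subst hηc
    exact hergodic.ae_tendsto_log_norm hFm hFC hFpsi hm hη hupF
  obtain ⟨htwo, htwoint, hmean⟩ := QPCocycle.twoSided_growth hFC hFpsi hm hone
  have hlyap : QPCocycle.lyapunovExponent ν = c := hmean.limUnder_eq
  rw [hbeta, hlyap]
  refine ⟨⟨fun η hη => ?_, hc⟩, hone, ⟨htwo, htwoint, hmean, rfl⟩, fun θ v => ?_, ?_⟩
  · have := hη.1
    exact QPCocycle.integrable_psi hFm hFC hFpsi η
  · rcases eq_or_ne v 0 with rfl | hv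
    -- Here `⊥ / n = ⊥` holds only for `n > 0`, hence the restriction to `n ≥ 1`.
    · refine ae_of_all _ fun ω => ?_
      refine (limsup_le_limsup (v := fun _ => (c : EReal)) ?_).trans (by simp)
      filter_upwards [eventually_ge_atTop 1] with n hn
      have hn' : (0 : ℝ) < n := by exact_mod_cast hn
      rw [map_zero, enorm_zero, ENNReal.log_zero, EReal.bot_div_of_pos_ne_top
        (by exact_mod_cast hn') (EReal.coe_ne_top _)]
      exact bot_le
    · filter_upwards [QPCocycle.ae_tendsto_max_log_norm_apply hup θ hv] with ω hω
      exact limsup_log_enorm_div_le (fun n => QPCocycle.iterOp_ne_zero ω n θ hv) hω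
  · rintro ⟨c', hc'⟩ θ v hv
    have hcc : c' = c := by
      obtain ⟨η, hη, hηc⟩ := hc.1
      rw [← hηc, hc' η hη]
    -- All stationary integrals of `φ` equal `c`, so the maximum for `-φ` is `-c`, and the upper
    -- bound for `-F` is a lower bound for `F`.
    obtain ⟨c₂, ⟨⟨η, hη, hηc⟩, -⟩, hcavg₂⟩ := exists_isGreatest_integral ν (-φ)
    have hc₂ : c₂ = -c := by
      rw [← hηc, ← hcc, ← hc' η hη, halpha η hη, ← integral_neg]
      rfl
    have hdown := ae_tendsto_max_orbitSum ν (F := fun g x => -F g x) hFm.neg (C := C)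
      (fun g x => by rw [abs_neg]; exact hFC g x) (-φ)
      (fun x => by rw [integral_neg, ← hφ]; rfl) hcavg₂ (θ, projClass v hv)
    filter_upwards [hup (θ, projClass v hv), hdown, QPCocycle.ae_orbitSum_eq hFpsi] with ω h1 h2 he
    have hneg : ∀ n, orbitSum (fun g x => -F g x) n ω ((θ, projClass v hv) : TorusProj d m) =
        -orbitSum QPCocycle.psi n ω ((θ, projClass v hv) : TorusProj d m) := fun n => by
      rw [← he, orbitSum, orbitSum, Finset.sum_neg_distrib]
    simp only [hneg, hc₂, neg_div] at h2
    have h3 := (tendsto_natCast_atTop_atTop.const_div_atTop (Real.log ‖v‖)).add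
      (tendsto_of_tendsto_max h1 h2)
    rw [zero_add] at h3
    simpa only [QPCocycle.log_norm_iterOp_div ω θ v hv] using h3
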